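/- Theorem 6.3. Put $X=\{u(1+i)+v(1-i) : u,v\in\mathbb R,\ -1/2\le u,v<1/2\}$. For $z=u(1+i)+v(1-i)$ with $u,v\in\mathbb R$ let $\lfloor z\rfloor_T=\lfloor u+1/2\rfloor(1+i)+\lfloor v+1/2\rfloor(1-i)$, and let $T_T(z)=\frac1z-\lfloor \frac1z\rfloor_T$ for $z\neq0$ and $T_T(0)=0$. For $\alpha\in X$ Tanaka's sequence is $\alpha^T_{(1)}=\alpha$, $\alpha^T_{(n+1)}=T_T(\alpha^T_{(n)})$, which terminates if it reaches $0$. It is called purely periodic if it does not terminate and there is an integer $p\ge1$ with $\alpha^T_{(n+p)}=\alpha^T_{(n)}$ for all $n\ge1$. For $1\le j\le4$ define $$X_j=\{z\in X : |z-i^{k+j-1}(1+i)/2|>\sqrt2/2 \text{ for } k=0,1,2\},\qquad X_{j+4}=\{z\in X : |z-i^{k+j-1}(1-i)/2|<\sqrt2/2\text{ for }k=0,1\},$$ $$W_j=\{z\in\mathbb C : |z|>1,\ |z-i^{j-1}(1-i)|\ge1\},\qquad W_{j+4}=\{z\in\mathbb C : |z|>1,\ |z-i^{k+j-1}(1-i)|\ge1\text{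 for }k=0,1\},$$ $$K_j=\{z\in\mathbb C : |z-i^{j-1}(\tfrac12-\tfrac12i)|=\tfrac{\sqrt2}2,\ |z|\le1\},\qquad K_j'=\{z\in\mathbb C : |z-i^{j-1}(\tfrac12-\tfrac12i)|=\tfrac{\sqrt2}2,\ |z|>1\},$$ $$Y_j=\{i^{j-1}(s-it) : s,t\in\mathbb R,\ s+t=1,\ 0\le s\le1\},\qquad Y_j'=\{i^{j-1}(s-it) : s,t\in\mathbb R,\ s+t=1,\ s\le0,\ t\ge1\},$$ and let $$N_2=\bigcup_{1\le j\le8}(X_j\times W_j)\cup\bigcup_{3\le j\le4}(Y_j\times Y_j')\cup\bigcup_{1\le j\le2}(K_j\times K_j').$$ Then for every $\alpha\in X\setminus\mathbb Q(i)$, the sequence $(\alpha^T_{(n)})_{n\ge1}$ is purely periodic if and only if $\alpha$ is a quadratic irrational over $\mathbb Q(i)$ (algebraic over $\mathbb{Q}(i)$ of degree exactly $2$) and $(\alpha,\alpha')\in N_2$, where $\alpha'$ denotes the conjugate of $\alpha$ over $\mathbb Q(i)$, i.e. the other root of its minimal polynomial. -/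

import Mathlib

noncomputable section

namespace HurwitzTanaka

/-- The field `ℚ(i)`, as a subfield of `ℂ`. -/
abbrev GaussQ : IntermediateField ℚ ℂ := IntermediateField.adjoin ℚ {Complex.I}

/-- `X = {u(1+i) + v(1-i) | -1/2 ≤ u, v < 1/2}`. -/
def X : Set ℂ :=
  {z | ∃ u v : ℝ, -1 / 2 ≤ u ∧ u < 1 / 2 ∧ -1 / 2 ≤ v ∧ v < 1 / 2 ∧
    z = (u : ℂ) * (1 + Complex.I) + (v : ℂ) * (1 - Complex.I)}

/-- The coordinate `u` in `z = u(1+i) + v(1-i)`. -/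
def coordU (z : ℂ) : ℝ := (z.re + z.im) / 2

/-- The coordinate `v` in `z = u(1+i) + v(1-i)`. -/
def coordV (z : ℂ) : ℝ := (z.re - z.im) / 2

/-- `coordU z` and `coordV z` are the unique real `u`, `v` with `z = u(1+i) + v(1-i)`. -/
theorem eq_coord_iff (z : ℂ) (u v : ℝ) :
    z = (u : ℂ) * (1 + Complex.I) + (v : ℂ) * (1 - Complex.I) ↔
      u = coordU z ∧ v = coordV z := by
  simp only [Complex.ext_iff, coordU, coordV]
  simp
  constructor
  · rintro ⟨h1, h2⟩
    constructor <;> linarith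
  · rintro ⟨h1, h2⟩
    constructor <;> linarith

/-- `⌊z⌋_T = ⌊u + 1/2⌋ (1+i) + ⌊v + 1/2⌋ (1-i)` for `z = u(1+i) + v(1-i)`. -/
def floorT (z : ℂ) : ℂ :=
  (⌊coordU z + 1 / 2⌋ : ℂ) * (1 + Complex.I) + (⌊coordV z + 1 / 2⌋ : ℂ) * (1 - Complex.I)

open Classical in
/-- Tanaka's transformation: `T_T(z) = 1/z - ⌊1/z⌋_T` for `z ≠ 0`, and `T_T(0) = 0`. -/
def mapT (z : ℂ) : ℂ := if z = 0 then 0 else 1 / z - floorT (1 / z)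

/-- Tanaka's orbit, indexed from `0`: `orbitT α n` is `α_(n+1)^T`, so `orbitT α 0 = α`.
The algorithm stops when it reaches `0`; here the orbit then stays at `0`. -/
def orbitT (α : ℂ) : ℕ → ℂ
  | 0 => α
  | n + 1 => mapT (orbitT α n)

/-- Tanaka's sequence of `α` does not terminate and is purely periodic. -/
def PurelyPeriodicT (α : ℂ) : Prop :=
  (∀ n, orbitT α n ≠ 0) ∧ ∃ p : ℕ, 0 < p ∧ ∀ n, orbitT α (n + p) = orbitT α n

/-- `α` is a quadratic irrational over `ℚ(i)`: algebraic over `ℚ(i)` of degree exactly two. -/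
def IsQuadraticIrrational (α : ℂ) : Prop := (minpoly GaussQ α).natDegree = 2

/-- `β` is the conjugate of the quadratic irrational `α` over `ℚ(i)`: the root of the minimal
polynomial of `α` other than `α`. -/
def IsQuadraticConjugate (α β : ℂ) : Prop :=
  β ≠ α ∧ Polynomial.aeval β (minpoly GaussQ α) = 0

/-- `X_j`, used for `1 ≤ j ≤ 4`. -/
def XOuter (j : ℕ) : Set ℂ :=
  {z | z ∈ X ∧ ∀ k : ℕ, k ≤ 2 →
    √2 / 2 < ‖z - Complex.I ^ (k + j - 1) * (1 + Complex.I) / 2‖}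

/-- `X_{j+4}`, used for `1 ≤ j ≤ 4`. -/
def XPetal (j : ℕ) : Set ℂ :=
  {z | z ∈ X ∧ ∀ k : ℕ, k ≤ 1 →
    ‖z - Complex.I ^ (k + j - 1) * (1 - Complex.I) / 2‖ < √2 / 2}

/-- `W_j`, used for `1 ≤ j ≤ 4`. -/
def WOuter (j : ℕ) : Set ℂ :=
  {z | 1 < ‖z‖ ∧ 1 ≤ ‖z - Complex.I ^ (j - 1) * (1 - Complex.I)‖}

/-- `W_{j+4}`, used for `1 ≤ j ≤ 4`. -/
def WPetal (j : ℕ) : Set ℂ :=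
  {z | 1 < ‖z‖ ∧ ∀ k : ℕ, k ≤ 1 →
    1 ≤ ‖z - Complex.I ^ (k + j - 1) * (1 - Complex.I)‖}

/-- The arc `K_j`, used for `1 ≤ j ≤ 4`. -/
def K (j : ℕ) : Set ℂ :=
  {z | ‖z - Complex.I ^ (j - 1) * (1 / 2 - 1 / 2 * Complex.I)‖ = √2 / 2 ∧ ‖z‖ ≤ 1}

/-- The arc `K_j'`, used for `1 ≤ j ≤ 4`. -/
def K' (j : ℕ) : Set ℂ :=
  {z | ‖z - Complex.I ^ (j - 1) * (1 / 2 - 1 / 2 * Complex.I)‖ = √2 / 2 ∧ 1 < ‖z‖}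

/-- The segment `Y_j`, used for `1 ≤ j ≤ 4`. -/
def Y (j : ℕ) : Set ℂ :=
  {z | ∃ s t : ℝ, s + t = 1 ∧ 0 ≤ s ∧ s ≤ 1 ∧
    z = Complex.I ^ (j - 1) * ((s : ℂ) - Complex.I * (t : ℂ))}

/-- The ray `Y_j'`, used for `1 ≤ j ≤ 4`. -/
def Y' (j : ℕ) : Set ℂ :=
  {z | ∃ s t : ℝ, s + t = 1 ∧ s ≤ 0 ∧ 1 ≤ t ∧
    z = Complex.I ^ (j - 1) * ((s : ℂ) - Complex.I * (t : ℂ))}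

/-- `N_2 = ⋃_{1≤j≤8} X_j × W_j ∪ ⋃_{3≤j≤4} Y_j × Y_j' ∪ ⋃_{1≤j≤2} K_j × K_j'`. -/
def N₂ : Set (ℂ × ℂ) :=
  (⋃ j ∈ Set.Icc 1 4, XOuter j ×ˢ WOuter j) ∪ (⋃ j ∈ Set.Icc 1 4, XPetal j ×ˢ WPetal j) ∪
    (⋃ j ∈ Set.Icc 3 4, Y j ×ˢ Y' j) ∪ (⋃ j ∈ Set.Icc 1 2, K j ×ˢ K' j)

end HurwitzTanaka

end

/-! The proof uses the natural extension (z, w) ↦ (1/z - d, 1/w - d), with d the digit of 1/z. In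
the coordinates re ± im the digit lattice is (2ℤ)², and `Good` is a domain preserved by this map
(`Good.step`): w lies outside the open unit disc and outside certain discs of radius 1 selected by
the position of z. On pairs with |w| > 1 the map is injective in the sense of `Good.injective`.

For a quadratic α, membership of (α, α') in N₂ is equivalent to `Good α α'`. The two regions differ
only on boundary circles, and there an arithmetic fact decides: if α lies on one of these circles,
so does α' (`RootPair.normSq_eq`, `RootPair.circle`).

If (α, α') is good, all pairs of conjugates along the orbit are good and have the same discriminant.
Only finitely many such points exist (`finite_reduced`), so the orbit repeats, and injectivity
carries the repetition back to α.

Conversely, a purely periodic α is fixed by a Möbius map of determinant ±1, hence quadratic. It has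
some good partner w, obtained from w = ∞ one step earlier. Following w through whole periods gives
good partners converging to α' (`dualOrbit_cross_ratio`), and goodness is closed in w. -/

namespace HurwitzTanaka

open Complex

/-! ### The natural extension in the coordinates `re + im`, `re - im` -/

/-- The bound `2 ≤ (S - 2k)² + (T - 2l)²` for lattice points away from the origin. -/
theorem two_le_of_far {S T : ℝ} (h : S ^ 2 + T ^ 2 ≤ 2) {k l : ℤ} (hkl : 2 ≤ k ^ 2 + l ^ 2) :
    2 ≤ (S - 2 * k) ^ 2 + (T - 2 * l) ^ 2 := by
  have h2 : (2 : ℝ) ≤ (k : ℝ) ^ 2 + (l : ℝ) ^ 2 := by exact_mod_cast hkl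
  -- The left side minus 2 is 2(S-k)² + 2(T-l)² + 2(k²+l²) - (S²+T²) - 2.
  nlinarith [sq_nonneg (S - k), sq_nonneg (T - l)]

theorem int_sq_add_sq_cases (k l : ℤ) :
    2 ≤ k ^ 2 + l ^ 2 ∨ (k = 0 ∧ l = 0) ∨ (k = 1 ∧ l = 0) ∨ (k = -1 ∧ l = 0) ∨
      (k = 0 ∧ l = 1) ∨ (k = 0 ∧ l = -1) := by
  by_cases h : 2 ≤ k ^ 2 + l ^ 2
  · exact Or.inl h
  · have hk : -1 ≤ k ∧ k ≤ 1 := by constructor <;> nlinarith [sq_nonneg l]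
    have hl : -1 ≤ l ∧ l ≤ 1 := by constructor <;> nlinarith [sq_nonneg k]
    obtain ⟨hk1, hk2⟩ := hk
    obtain ⟨hl1, hl2⟩ := hl
    interval_cases k <;> interval_cases l <;> simp_all

/-- The domain of the natural extension after inversion, in the coordinates
`U = re ζ + im ζ`, `V = re ζ - im ζ`, `S = re ω + im ω`, `T = re ω - im ω`. -/
structure Adm (U V S T : ℝ) : Prop where
  unit : S ^ 2 + T ^ 2 ≤ 2
  uPos : 1 < U → 2 ≤ (S - 2) ^ 2 + T ^ 2
  vPos : 1 < V → 2 ≤ S ^ 2 + (T - 2) ^ 2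
  uNeg : U ≤ -1 → 2 ≤ (S + 2) ^ 2 + T ^ 2
  vNeg : V ≤ -1 → 2 ≤ S ^ 2 + (T + 2) ^ 2

/-- Lattice points beyond the four nearest ones are avoided by the whole disc, so only those four
need a clause of `Adm`; `h1` to `h4` supply its premises. -/
theorem Adm.two_le {U V S T : ℝ} (h : Adm U V S T) (k l : ℤ)
    (h0 : k = 0 → l = 0 → False) (h1 : k = 1 → l = 0 → 1 < U) (h2 : k = -1 → l = 0 → U ≤ -1)
    (h3 : k = 0 → l = 1 → 1 < V) (h4 : k = 0 → l = -1 → V ≤ -1) :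
    2 ≤ (S - 2 * k) ^ 2 + (T - 2 * l) ^ 2 := by
  rcases int_sq_add_sq_cases k l with h' | ⟨hk, hl⟩ | ⟨hk, hl⟩ | ⟨hk, hl⟩ | ⟨hk, hl⟩ | ⟨hk, hl⟩
  · exact two_le_of_far h.unit h'
  · exact (h0 hk hl).elim
  · have := h.uPos (h1 hk hl); subst hk hl; norm_num; linarith
  · have := h.uNeg (h2 hk hl); subst hk hl; norm_num; linarith
  · have := h.vPos (h3 hk hl); subst hk hl; norm_num; linarith
  · have := h.vNeg (h4 hk hl); subst hk hl; norm_num; linarith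

/-- The inverted square `1 / X` without its ideal vertices. -/
structure InvX (U V : ℝ) : Prop where
  one_lt : 2 < U ^ 2 + V ^ 2
  uPos : 2 * U < U ^ 2 + V ^ 2
  vPos : 2 * V < U ^ 2 + V ^ 2
  uNeg : -(2 * U) ≤ U ^ 2 + V ^ 2
  vNeg : -(2 * V) ≤ U ^ 2 + V ^ 2

/-- The square `X` without its ideal vertices. -/
structure InX (U V : ℝ) : Prop where
  uLe : -1 ≤ U
  uLt : U < 1
  vLe : -1 ≤ V
  vLt : V < 1
  one_lt : U ^ 2 + V ^ 2 < 2

/-- The domain of the natural extension: `U, V` are the coordinates of `z` and `S, T` those of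
`w`. -/
structure Dom (U V S T : ℝ) : Prop where
  unit : 2 ≤ S ^ 2 + T ^ 2
  vPos : U ^ 2 + V ^ 2 < 2 * V → 2 ≤ S ^ 2 + (T - 2) ^ 2
  uPos : U ^ 2 + V ^ 2 < 2 * U → 2 ≤ (S - 2) ^ 2 + T ^ 2
  vNeg : U ^ 2 + V ^ 2 ≤ -(2 * V) → 2 ≤ S ^ 2 + (T + 2) ^ 2
  uNeg : U ^ 2 + V ^ 2 ≤ -(2 * U) → 2 ≤ (S + 2) ^ 2 + T ^ 2

/-- Translation turns each clause of `Dom` into avoidance of one lattice point. If that point is the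
origin, the position of the first coordinate contradicts `InvX` or `InX`; if it is one of the four
nearest, that position gives the premise needed from `Adm`. -/
theorem Adm.dom {U V S T : ℝ} {m n : ℤ} (h : Adm U V S T) (hI : InvX U V)
    (hX : InX (U - 2 * m) (V - 2 * n)) : Dom (U - 2 * m) (V - 2 * n) (S - 2 * m) (T - 2 * n) := by
  obtain ⟨i0, i1, i2, i3, i4⟩ := hI
  obtain ⟨x1, x2, x3, x4, x5⟩ := hX
  refine ⟨h.two_le m n ?_ ?_ ?_ ?_ ?_, fun hc => ?_, fun hc => ?_, fun hc => ?_, fun hc => ?_⟩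
  · rintro rfl rfl; norm_num at *; linarith
  -- The digit only gives 1 ≤ U. Equality would force V² > 1 by `InvX`, outside the square.
  · rintro rfl rfl; norm_num at *; by_contra hU
    have : U = 1 := by linarith
    subst this; nlinarith
  · rintro rfl rfl; norm_num at *; linarith
  · rintro rfl rfl; norm_num at *; by_contra hU
    have : V = 1 := by linarith
    subst this; nlinarith
  · rintro rfl rfl; norm_num at *; linarith
  -- A disc around (0, 2) for the translated point is a disc around (2m, 2(n+1)) for the original
  -- one.
  · have := h.two_le m (n + 1) ?_ ?_ ?_ ?_ ?_
    · push_cast at this; convert this using 2; ring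
    all_goals intro hm hn
    · obtain rfl : n = -1 := by omega
      subst hm; norm_num at *; nlinarith
    · obtain rfl : n = -1 := by omega
      subst hm; norm_num at *; by_contra hU
      have : U = 1 := by linarith
      subst this; nlinarith
    · obtain rfl : n = -1 := by omega
      subst hm; norm_num at *; linarith
    · obtain rfl : n = 0 := by omega
      subst hm; norm_num at *; nlinarith
    · obtain rfl : n = -2 := by omega
      subst hm; norm_num at *; linarith
  · have := h.two_le (m + 1) n ?_ ?_ ?_ ?_ ?_
    · push_cast at this; convert this using 2; ring
    all_goals intro hm hn
    · obtain rfl : m = -1 := by omega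
      subst hn; norm_num at *; nlinarith
    · obtain rfl : m = 0 := by omega
      subst hn; norm_num at *; nlinarith
    · obtain rfl : m = -2 := by omega
      subst hn; norm_num at *; linarith
    · obtain rfl : m = -1 := by omega
      subst hn; norm_num at *; by_contra hU
      have : V = 1 := by linarith
      subst this; nlinarith
    · obtain rfl : m = -1 := by omega
      subst hn; norm_num at *; linarith
  · have := h.two_le m (n - 1) ?_ ?_ ?_ ?_ ?_
    · push_cast at this; convert this using 2; ring
    all_goals intro hm hn
    · obtain rfl : n = 1 := by omega
      subst hm; norm_num at *; nlinarith
    · obtain rfl : n = 1 := by omega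
      subst hm; norm_num at *; by_contra hU
      have : U = 1 := by linarith
      subst this; nlinarith
    · obtain rfl : n = 1 := by omega
      subst hm; norm_num at *; linarith
    · obtain rfl : n = 2 := by omega
      subst hm; norm_num at *; linarith
    · obtain rfl : n = 0 := by omega
      subst hm; norm_num at *; nlinarith
  · have := h.two_le (m - 1) n ?_ ?_ ?_ ?_ ?_
    · push_cast at this; convert this using 2; ring
    all_goals intro hm hn
    · obtain rfl : m = 1 := by omega
      subst hn; norm_num at *; nlinarith
    · obtain rfl : m = 2 := by omega
      subst hn; norm_num at *; linarith
    · obtain rfl : m = 0 := by omega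
      subst hn; norm_num at *; nlinarith
    · obtain rfl : m = 1 := by omega
      subst hn; norm_num at *; by_contra hU
      have : V = 1 := by linarith
      subst this; nlinarith
    · obtain rfl : m = 1 := by omega
      subst hn; norm_num at *; linarith

/-- Two admissible points that differ by a lattice vector coincide. -/
theorem Adm.eq_of_lattice {U V S T : ℝ} {k l : ℤ} (h : Adm U V S T)
    (h' : Adm (U - 2 * k) (V - 2 * l) (S - 2 * k) (T - 2 * l)) (hs : S ^ 2 + T ^ 2 < 2)
    (hs' : (S - 2 * k) ^ 2 + (T - 2 * l) ^ 2 < 2) : k = 0 ∧ l = 0 := by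
  rcases int_sq_add_sq_cases k l with h1 | h1 | ⟨rfl, rfl⟩ | ⟨rfl, rfl⟩ | ⟨rfl, rfl⟩ | ⟨rfl, rfl⟩
  · linarith [two_le_of_far hs.le h1]
  · exact h1
  · exfalso
    have a := h.uPos
    have b := h'.uNeg
    norm_num at *
    -- The half-planes 1 < U and U - 2 ≤ -1 are complementary, so one of the two points is pushed
    -- out of the open disc. The other three directions are alike.
    by_cases hU : 1 < U
    · linarith [a hU]
    · linarith [b (by linarith)]
  · exfalso
    have a := h.uNeg
    have b := h'.uPos
    norm_num at *
    by_cases hU : U ≤ -1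
    · linarith [a hU]
    · linarith [b (by linarith)]
  · exfalso
    have a := h.vPos
    have b := h'.vNeg
    norm_num at *
    by_cases hU : 1 < V
    · linarith [a hU]
    · linarith [b (by linarith)]
  · exfalso
    have a := h.vNeg
    have b := h'.vPos
    norm_num at *
    by_cases hU : V ≤ -1
    · linarith [a hU]
    · linarith [b (by linarith)]

/-! ### The natural extension on complex pairs -/

/-- `(z, w)` lies in the (weak) domain of the natural extension. -/
def Good (z w : ℂ) : Prop :=
  Dom (z.re + z.im) (z.re - z.im) (w.re + w.im) (w.re - w.im)

/-- The image of `Good` under `(z, w) ↦ (1 / z, 1 / w)`, including `1 / w = 0`. -/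
def InvGood (ζ ω : ℂ) : Prop :=
  Adm (ζ.re + ζ.im) (ζ.re - ζ.im) (ω.re + ω.im) (ω.re - ω.im)

theorem sq_coords (z : ℂ) : (z.re + z.im) ^ 2 + (z.re - z.im) ^ 2 = 2 * normSq z := by
  rw [normSq_apply]; ring

theorem inv_coord_add (z : ℂ) : z⁻¹.re + z⁻¹.im = (z.re - z.im) / normSq z := by
  rw [inv_re, inv_im]; ring

theorem inv_coord_sub (z : ℂ) : z⁻¹.re - z⁻¹.im = (z.re + z.im) / normSq z := by
  rw [inv_re, inv_im]; ring

/-- The circles of radius 1 about ±1±i are orthogonal to the unit circle, so w ↦ 1/w sends each to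
its complex conjugate and keeps exteriors. Conjugation exchanges the coordinates S and T. -/
theorem two_le_inv_coords {S T M e : ℝ} (hST : S ^ 2 + T ^ 2 = 2 * M) (hM : 0 < M)
    (he : e ^ 2 = 4) (h : 2 ≤ S ^ 2 + (T - e) ^ 2) : 2 ≤ (T / M - e) ^ 2 + (S / M) ^ 2 := by
  have h1 : (T / M - e) ^ 2 + (S / M) ^ 2 - 2 = (2 - 2 * e * T + 2 * M) / M := by
    have : (T / M - e) ^ 2 + (S / M) ^ 2 = (S ^ 2 + T ^ 2) / M ^ 2 - 2 * e * T / M + e ^ 2 := by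
      ring
    rw [this, hST, he]
    field_simp
    ring
  have h2 : 0 ≤ (2 - 2 * e * T + 2 * M) / M := div_nonneg (by nlinarith) hM.le
  linarith

theorem Good.one_le {z w : ℂ} (h : Good z w) : 1 ≤ normSq w := by
  have := h.unit
  rw [sq_coords] at this
  linarith

theorem Good.inv {z w : ℂ} (hz : z ≠ 0) (h : Good z w) : InvGood z⁻¹ w⁻¹ := by
  have hN : 0 < normSq z := normSq_pos.2 hz
  have hw := h.one_le
  have hM : 0 < normSq w := by linarith
  obtain ⟨h0, h1, h2, h3, h4⟩ := h
  have hST := sq_coords w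
  have hST' : (w.re - w.im) ^ 2 + (w.re + w.im) ^ 2 = 2 * normSq w := by linarith
  rw [sq_coords] at h0 h1 h2 h3 h4
  unfold InvGood
  rw [inv_coord_add, inv_coord_sub, inv_coord_add, inv_coord_sub]
  refine ⟨?_, fun hc => ?_, fun hc => ?_, fun hc => ?_, fun hc => ?_⟩
  · rw [← inv_coord_add, ← inv_coord_sub, sq_coords, map_inv₀]
    have : (normSq w)⁻¹ ≤ 1 := inv_le_one_of_one_le₀ hw
    linarith
  · rw [lt_div_iff₀ hN] at hc
    exact two_le_inv_coords hST hM (by norm_num) (h1 (by linarith))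
  · rw [lt_div_iff₀ hN] at hc
    have := two_le_inv_coords hST' hM (e := 2) (by norm_num) (by linarith [h2 (by linarith)])
    linarith
  · rw [div_le_iff₀ hN] at hc
    have := two_le_inv_coords hST hM (e := -2) (by norm_num)
      (by rw [sub_neg_eq_add]; exact h3 (by linarith))
    rwa [sub_neg_eq_add] at this
  · rw [div_le_iff₀ hN] at hc
    have := two_le_inv_coords hST' hM (e := -2) (by norm_num)
      (by rw [sub_neg_eq_add]; linarith [h4 (by linarith)])
    rw [sub_neg_eq_add] at this
    linarith

/-! ### Irrational points of the square and their digits. -/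

theorem mem_X_iff (z : ℂ) : z ∈ X ↔
    -1 ≤ z.re + z.im ∧ z.re + z.im < 1 ∧ -1 ≤ z.re - z.im ∧ z.re - z.im < 1 := by
  constructor
  · rintro ⟨u, v, h1, h2, h3, h4, h5⟩
    obtain ⟨rfl, rfl⟩ := (eq_coord_iff _ _ _).1 h5
    simp only [coordU, coordV] at *
    refine ⟨?_, ?_, ?_, ?_⟩ <;> linarith
  · rintro ⟨h1, h2, h3, h4⟩
    refine ⟨coordU z, coordV z, ?_, ?_, ?_, ?_, (eq_coord_iff _ _ _).2 ⟨rfl, rfl⟩⟩ <;>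
      simp only [coordU, coordV] <;> linarith

theorem I_mem_gaussQ : I ∈ GaussQ := IntermediateField.mem_adjoin_simple_self ℚ I

theorem toComplex_mem_gaussQ (g : GaussianInt) : (g : ℂ) ∈ GaussQ := by
  rw [GaussianInt.toComplex_def]
  exact add_mem (intCast_mem _ _) (mul_mem (intCast_mem _ _) I_mem_gaussQ)

/-- The only point of the half-open square with |z| ≥ 1 is the vertex -1, which is rational. -/
theorem inX_of_mem {z : ℂ} (hz : z ∈ X) (hi : z ∉ GaussQ) :
    InX (z.re + z.im) (z.re - z.im) := by
  obtain ⟨h1, h2, h3, h4⟩ := (mem_X_iff z).1 hz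
  refine ⟨h1, h2, h3, h4, ?_⟩
  by_contra hc
  have e1 : z.re + z.im = -1 := by nlinarith
  have e2 : z.re - z.im = -1 := by nlinarith
  apply hi
  have : z = -1 := by apply Complex.ext <;> simp <;> linarith
  rw [this]
  exact neg_mem (one_mem _)

theorem ne_zero_of_not_mem {z : ℂ} (hi : z ∉ GaussQ) : z ≠ 0 := by
  rintro rfl; exact hi (zero_mem _)

theorem normSq_lt_one {z : ℂ} (hz : z ∈ X) (hi : z ∉ GaussQ) : normSq z < 1 := by
  have := (inX_of_mem hz hi).one_lt
  rw [sq_coords] at this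
  linarith

theorem invX_of_mem {z : ℂ} (hz : z ∈ X) (hi : z ∉ GaussQ) :
    InvX (z⁻¹.re + z⁻¹.im) (z⁻¹.re - z⁻¹.im) := by
  obtain ⟨h1, h2, h3, h4, -⟩ := inX_of_mem hz hi
  have hN : 0 < normSq z := normSq_pos.2 (ne_zero_of_not_mem hi)
  have hN1 := (one_lt_inv₀ hN).2 (normSq_lt_one hz hi)
  constructor <;> rw [sq_coords, map_inv₀]
  · linarith
  all_goals
    first | rw [inv_coord_add] | rw [inv_coord_sub]
    rw [div_eq_mul_inv]
    nlinarith [inv_pos.2 hN]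

theorem mapT_eq {z : ℂ} (hz : z ≠ 0) : mapT z = z⁻¹ - floorT z⁻¹ := by
  simp [mapT, hz]

/-- The digit `⌊z⌋_T` as a Gaussian integer. -/
noncomputable def digit (z : ℂ) : GaussianInt :=
  ⟨⌊coordU z + 1 / 2⌋ + ⌊coordV z + 1 / 2⌋, ⌊coordU z + 1 / 2⌋ - ⌊coordV z + 1 / 2⌋⟩

theorem floorT_eq (z : ℂ) : floorT z = digit z := by
  rw [GaussianInt.toComplex_def, floorT, digit]
  push_cast
  ring

theorem mapT_eq_digit {z : ℂ} (hz : z ≠ 0) : mapT z = z⁻¹ - digit z⁻¹ := by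
  rw [mapT_eq hz, floorT_eq]

theorem sub_digit_add (w z : ℂ) : (w - digit z).re + (w - digit z).im =
    w.re + w.im - 2 * ⌊coordU z + 1 / 2⌋ := by
  simp [GaussianInt.toComplex_def, digit]; ring

theorem sub_digit_sub (w z : ℂ) : (w - digit z).re - (w - digit z).im =
    w.re - w.im - 2 * ⌊coordV z + 1 / 2⌋ := by
  simp [GaussianInt.toComplex_def, digit]; ring

theorem sub_digit_mem_X (z : ℂ) : z - digit z ∈ X := by
  rw [mem_X_iff, sub_digit_add, sub_digit_sub]
  have h1 := Int.floor_le (coordU z + 1 / 2)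
  have h2 := Int.lt_floor_add_one (coordU z + 1 / 2)
  have h3 := Int.floor_le (coordV z + 1 / 2)
  have h4 := Int.lt_floor_add_one (coordV z + 1 / 2)
  generalize (⌊coordU z + 1 / 2⌋ : ℤ) = m at *
  generalize (⌊coordV z + 1 / 2⌋ : ℤ) = n at *
  unfold coordU coordV at *
  refine ⟨?_, ?_, ?_, ?_⟩ <;> linarith

theorem sub_digit_not_mem {z : ℂ} (hi : z ∉ GaussQ) (w : ℂ) : z - digit w ∉ GaussQ := fun h =>
  hi (by simpa using add_mem h (toComplex_mem_gaussQ (digit w)))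

theorem inv_not_mem {z : ℂ} (hi : z ∉ GaussQ) : z⁻¹ ∉ GaussQ := fun h =>
  hi (by simpa using inv_mem h)

theorem mapT_mem_X {z : ℂ} (hi : z ∉ GaussQ) : mapT z ∈ X := by
  rw [mapT_eq_digit (ne_zero_of_not_mem hi)]
  exact sub_digit_mem_X _

theorem mapT_not_mem {z : ℂ} (hi : z ∉ GaussQ) : mapT z ∉ GaussQ := by
  rw [mapT_eq_digit (ne_zero_of_not_mem hi)]
  exact sub_digit_not_mem (inv_not_mem hi) _

theorem InvGood.step {z ω : ℂ} (hz : z ∈ X) (hi : z ∉ GaussQ) (h : InvGood z⁻¹ ω) :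
    Good (mapT z) (ω - digit z⁻¹) := by
  have h1 := inX_of_mem (mapT_mem_X hi) (mapT_not_mem hi)
  rw [mapT_eq_digit (ne_zero_of_not_mem hi)] at *
  unfold Good
  rw [sub_digit_add, sub_digit_sub] at *
  rw [sub_digit_add, sub_digit_sub]
  exact Adm.dom h (invX_of_mem hz hi) h1

theorem Good.step {z w : ℂ} (hz : z ∈ X) (hi : z ∉ GaussQ) (h : Good z w) :
    Good (mapT z) (w⁻¹ - digit z⁻¹) :=
  (h.inv (ne_zero_of_not_mem hi)).step hz hi

/-- This is the point w = ∞, a partner admissible for every first coordinate. -/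
theorem invGood_zero (ζ : ℂ) : InvGood ζ 0 := by
  constructor <;> norm_num

/-- The natural extension is injective on its domain. -/
theorem Good.injective {z₁ z₂ w₁ w₂ : ℂ} (hi₁ : z₁ ∉ GaussQ) (hi₂ : z₂ ∉ GaussQ)
    (h₁ : Good z₁ w₁) (h₂ : Good z₂ w₂) (hw₁ : 1 < normSq w₁) (hw₂ : 1 < normSq w₂)
    (hz : mapT z₁ = mapT z₂) (hw : w₁⁻¹ - digit z₁⁻¹ = w₂⁻¹ - digit z₂⁻¹) : z₁ = z₂ := by
  have a₁ := h₁.inv (ne_zero_of_not_mem hi₁)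
  have a₂ := h₂.inv (ne_zero_of_not_mem hi₂)
  rw [mapT_eq_digit (ne_zero_of_not_mem hi₁), mapT_eq_digit (ne_zero_of_not_mem hi₂)] at hz
  have s₁ : normSq w₁⁻¹ < 1 := by rw [map_inv₀]; exact inv_lt_one_of_one_lt₀ hw₁
  have s₂ : normSq w₂⁻¹ < 1 := by rw [map_inv₀]; exact inv_lt_one_of_one_lt₀ hw₂
  have t₁ := sq_coords w₁⁻¹
  have t₂ := sq_coords w₂⁻¹
  have z1 := congrArg (fun z : ℂ => z.re + z.im) hz
  have z2 := congrArg (fun z : ℂ => z.re - z.im) hz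
  have w1 := congrArg (fun z : ℂ => z.re + z.im) hw
  have w2 := congrArg (fun z : ℂ => z.re - z.im) hw
  simp only [sub_digit_add, sub_digit_sub] at z1 z2 w1 w2
  unfold InvGood at a₁ a₂
  set k : ℤ := ⌊coordU z₁⁻¹ + 1 / 2⌋ - ⌊coordU z₂⁻¹ + 1 / 2⌋ with hk
  set l : ℤ := ⌊coordV z₁⁻¹ + 1 / 2⌋ - ⌊coordV z₂⁻¹ + 1 / 2⌋ with hl
  have hkr := congrArg (Int.cast (R := ℝ)) hk
  have hlr := congrArg (Int.cast (R := ℝ)) hl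
  push_cast at hkr hlr
  have e1 : z₂⁻¹.re + z₂⁻¹.im = z₁⁻¹.re + z₁⁻¹.im - 2 * k := by rw [hkr]; linarith
  have e2 : z₂⁻¹.re - z₂⁻¹.im = z₁⁻¹.re - z₁⁻¹.im - 2 * l := by rw [hlr]; linarith
  have e3 : w₂⁻¹.re + w₂⁻¹.im = w₁⁻¹.re + w₁⁻¹.im - 2 * k := by rw [hkr]; linarith
  have e4 : w₂⁻¹.re - w₂⁻¹.im = w₁⁻¹.re - w₁⁻¹.im - 2 * l := by rw [hlr]; linarith
  rw [e1, e2, e3, e4] at a₂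
  rw [e3, e4] at t₂
  obtain ⟨k0, l0⟩ := a₁.eq_of_lattice a₂ (by linarith) (by linarith)
  rw [k0] at e1
  rw [l0] at e2
  simp only [Int.cast_zero, mul_zero, sub_zero] at e1 e2
  apply inv_injective
  apply Complex.ext <;> linarith

/-! ### Quadratic irrationals over `ℚ(i)` and their integral equations -/

/-- `α` and `β` are the two roots of `A z² + B z + C`. -/
structure RootPair (A B C : GaussianInt) (α β : ℂ) : Prop where
  ne : A ≠ 0
  sum : (A : ℂ) * (α + β) = -B
  prod : (A : ℂ) * (α * β) = C

theorem eq_zero_of_linear {z : ℂ} (hi : z ∉ GaussQ) {p q : GaussianInt}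
    (h : (p : ℂ) * z + q = 0) : p = 0 ∧ q = 0 := by
  have hp : p = 0 := by
    by_contra hp
    have hp' : (p : ℂ) ≠ 0 := fun h => hp (GaussianInt.toComplex_eq_zero.1 h)
    apply hi
    have : z = -(q : ℂ) / p := by rw [eq_div_iff hp']; linear_combination h
    rw [this]
    exact div_mem (neg_mem (toComplex_mem_gaussQ q)) (toComplex_mem_gaussQ p)
  subst hp
  simpa using h

namespace RootPair

variable {A B C : GaussianInt} {α β : ℂ}

theorem ne' (h : RootPair A B C α β) : (A : ℂ) ≠ 0 :=
  fun h' => h.ne (GaussianInt.toComplex_eq_zero.1 h')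

theorem symm (h : RootPair A B C α β) : RootPair A B C β α :=
  ⟨h.ne, by rw [add_comm, h.sum], by rw [mul_comm β, h.prod]⟩

theorem eval (h : RootPair A B C α β) : (A : ℂ) * α ^ 2 + B * α + C = 0 := by
  linear_combination α * h.sum - h.prod

theorem conj_eq (h : RootPair A B C α β) : β = -B / A - α := by
  rw [eq_sub_iff_add_eq, eq_div_iff h.ne']
  linear_combination h.sum

theorem not_mem (h : RootPair A B C α β) (hi : α ∉ GaussQ) : β ∉ GaussQ := fun hb => hi <| by
  rw [h.symm.conj_eq]
  exact sub_mem (div_mem (neg_mem (toComplex_mem_gaussQ B)) (toComplex_mem_gaussQ A)) hb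

theorem ne_conj (h : RootPair A B C α β) (hi : α ∉ GaussQ) : α ≠ β := by
  intro e
  have h1 := h.sum
  rw [← e] at h1
  have h2 := (eq_zero_of_linear hi (p := 2 * A) (q := B) (by
    simp only [map_mul, map_ofNat]
    linear_combination h1)).1
  rcases mul_eq_zero.1 h2 with h3 | h3
  · exact absurd (congrArg Zsqrtd.re h3) (by decide)
  · exact h.ne h3

/-- Eliminating α² between the two equations leaves a linear one, which must vanish identically. -/
theorem proportional (h : RootPair A B C α β) (hi : α ∉ GaussQ) {A' B' C' : GaussianInt}
    (h' : (A' : ℂ) * α ^ 2 + B' * α + C' = 0) : A' * B = A * B' ∧ A' * C = A * C' := by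
  have := eq_zero_of_linear hi (p := A' * B - A * B') (q := A' * C - A * C') (by
    simp only [map_sub, map_mul]
    linear_combination (A' : ℂ) * h.eval - A * h')
  exact ⟨sub_eq_zero.1 this.1, sub_eq_zero.1 this.2⟩

theorem conj_unique (h : RootPair A B C α β) (hi : α ∉ GaussQ) {A' B' C' : GaussianInt}
    {β' : ℂ} (h' : RootPair A' B' C' α β') : β' = β := by
  have h1 := congrArg GaussianInt.toComplex (h.proportional hi h'.eval).1
  simp only [map_mul] at h1
  rw [h.conj_eq, h'.conj_eq, sub_left_inj, div_eq_div_iff h'.ne' h.ne']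
  linear_combination h1

theorem last_ne_zero (h : RootPair A B C α β) (hi : α ∉ GaussQ) : C ≠ 0 := by
  intro hC
  have := h.prod
  rw [hC, map_zero] at this
  rcases mul_eq_zero.1 this with h1 | h1
  · exact h.ne' h1
  · rcases mul_eq_zero.1 h1 with h2 | h2
    · exact ne_zero_of_not_mem hi h2
    · exact ne_zero_of_not_mem (h.not_mem hi) h2

theorem step (h : RootPair A B C α β) (hi : α ∉ GaussQ) (g : GaussianInt) :
    RootPair C (B + 2 * C * g) (A + B * g + C * g ^ 2) (α⁻¹ - g) (β⁻¹ - g) := by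
  have ha := ne_zero_of_not_mem hi
  have hb := ne_zero_of_not_mem (h.not_mem hi)
  have e1 : (C : ℂ) * (α⁻¹ + β⁻¹) = -B := by
    rw [← h.prod, ← h.sum]; field_simp; ring
  have e2 : (C : ℂ) * (α⁻¹ * β⁻¹) = A := by
    rw [← h.prod]; field_simp
  refine ⟨h.last_ne_zero hi, ?_, ?_⟩
  · simp only [map_add, map_mul, map_ofNat]
    linear_combination e1
  · simp only [map_add, map_mul, map_pow]
    linear_combination e2 - (g : ℂ) * e1

theorem disc_eq (h : RootPair A B C α β) :
    ((A : ℂ) * (α - β)) ^ 2 = ((B ^ 2 - 4 * A * C : GaussianInt) : ℂ) := by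
  simp only [map_sub, map_mul, map_pow, map_ofNat, ← h.prod]
  linear_combination ((A : ℂ) * (α + β) - B) * h.sum

theorem affine (h : RootPair A B C α β) (c : GaussianInt) :
    RootPair A (2 * B + 2 * A * c) (4 * C + 2 * c * B + A * c ^ 2) (2 * α - c) (2 * β - c) := by
  refine ⟨h.ne, ?_, ?_⟩
  · simp only [map_add, map_mul, map_ofNat]
    linear_combination 2 * h.sum
  · simp only [map_add, map_mul, map_pow, map_ofNat]
    linear_combination 4 * h.prod - 2 * (c : ℂ) * h.sum

/-- If one root lies on a circle `|z|² = n`, so does the other. -/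
theorem normSq_eq (h : RootPair A B C α β) (hi : α ∉ GaussQ) {n : ℕ} (hn : normSq α = n) :
    normSq β = n := by
  -- Conjugating the equation and replacing the conjugate of α by n/α gives a second quadratic
  -- equation for α. Proportionality yields |C|² = n²|A|², hence |αβ| = n.
  have hc := congrArg (starRingEnd ℂ) h.eval
  simp only [map_add, map_mul, map_pow, map_zero, ← GaussianInt.toComplex_star] at hc
  have hz : starRingEnd ℂ α * α = n := by rw [mul_comm, mul_conj, hn]; simp
  have h1 : ((star C : GaussianInt) : ℂ) * α ^ 2 + ((n * star B : GaussianInt) : ℂ) * α +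
      ((n ^ 2 * star A : GaussianInt) : ℂ) = 0 := by
    simp only [map_mul, map_pow, map_natCast, ← hz]
    linear_combination α ^ 2 * hc
  have h2 := congrArg GaussianInt.toComplex (h.proportional hi h1).2
  simp only [map_mul, map_pow, map_natCast, GaussianInt.toComplex_star] at h2
  have h3 := congrArg normSq h2
  simp only [map_mul, map_pow, normSq_conj, normSq_natCast] at h3
  rw [← h.prod] at h3
  simp only [map_mul, hn] at h3
  have hA := normSq_pos.2 h.ne'
  have hn0 : 0 < (n : ℝ) := hn ▸ normSq_pos.2 (ne_zero_of_not_mem hi)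
  have hb := normSq_nonneg β
  have h4 : (normSq β) ^ 2 = (n : ℝ) ^ 2 := by
    have h5 : (normSq (A : ℂ) * n) ^ 2 * normSq β ^ 2 = (normSq (A : ℂ) * n) ^ 2 * (n : ℝ) ^ 2 := by
      linear_combination h3
    exact mul_left_cancel₀ (by positivity) h5
  exact (pow_left_inj₀ hb hn0.le two_ne_zero).1 h4

end RootPair

/-! ### Integral equations and minimal polynomials over ℚ(i). -/

theorem exists_rat_of_mem {z : ℂ} (h : z ∈ GaussQ) : ∃ x y : ℚ, z = x + y * I := by
  induction h using IntermediateField.adjoin_induction with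
  | mem x hx => exact ⟨0, 1, by simpa using hx⟩
  | algebraMap x => exact ⟨x, 0, by simp⟩
  | add x y _ _ hx hy =>
    obtain ⟨a, b, rfl⟩ := hx
    obtain ⟨c, d, rfl⟩ := hy
    exact ⟨a + c, b + d, by push_cast; ring⟩
  | inv x _ hx =>
    obtain ⟨a, b, rfl⟩ := hx
    refine ⟨a / (a ^ 2 + b ^ 2), -b / (a ^ 2 + b ^ 2), ?_⟩
    have h1 : starRingEnd ℂ ((a : ℂ) + b * I) = a - b * I := by
      apply Complex.ext <;> simp
    have h2 : normSq ((a : ℂ) + b * I) = (a : ℝ) ^ 2 + (b : ℝ) ^ 2 := by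
      rw [normSq_apply]; simp; ring
    rw [Complex.inv_def, h1, h2]
    push_cast
    ring
  | mul x y _ _ hx hy =>
    obtain ⟨a, b, rfl⟩ := hx
    obtain ⟨c, d, rfl⟩ := hy
    refine ⟨a * c - b * d, a * d + b * c, ?_⟩
    push_cast
    linear_combination (b * d : ℂ) * I_sq

theorem exists_denom {z : ℂ} (h : z ∈ GaussQ) :
    ∃ d : ℕ, d ≠ 0 ∧ ∃ g : GaussianInt, (d : ℂ) * z = g := by
  obtain ⟨x, y, rfl⟩ := exists_rat_of_mem h
  refine ⟨x.den * y.den, mul_ne_zero x.den_nz y.den_nz, ⟨x.num * y.den, y.num * x.den⟩, ?_⟩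
  have hx : (x.den : ℂ) * x = x.num := by exact_mod_cast Rat.den_mul_eq_num x
  have hy : (y.den : ℂ) * y = y.num := by exact_mod_cast Rat.den_mul_eq_num y
  rw [GaussianInt.toComplex_def]
  push_cast
  linear_combination (y.den : ℂ) * hx + (x.den : ℂ) * I * hy

open Polynomial in
theorem exists_rootPair {α β : ℂ} (h : IsQuadraticIrrational α) (hc : IsQuadraticConjugate α β) :
    ∃ A B C, RootPair A B C α β := by
  obtain ⟨hne, hβ⟩ := hc
  unfold IsQuadraticIrrational at h
  have hint : IsIntegral GaussQ α := by
    by_contra hn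
    rw [minpoly.eq_zero hn] at h
    simp at h
  have hm : (minpoly GaussQ α).coeff 2 = 1 := by rw [← h]; exact minpoly.monic hint
  have hα := minpoly.aeval GaussQ α
  rw [aeval_eq_sum_range, h] at hα hβ
  simp only [Finset.sum_range_succ, Finset.sum_range_zero, hm, Algebra.smul_def, map_one] at hα hβ
  set b := (minpoly GaussQ α).coeff 1
  set c := (minpoly GaussQ α).coeff 0
  change 0 + (c : ℂ) * α ^ 0 + (b : ℂ) * α ^ 1 + 1 * α ^ 2 = 0 at hα
  change 0 + (c : ℂ) * β ^ 0 + (b : ℂ) * β ^ 1 + 1 * β ^ 2 = 0 at hβ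
  have hs : α + β = -b := by
    have : (β - α) * (α + β + b) = 0 := by linear_combination hβ - hα
    rcases mul_eq_zero.1 this with h1 | h1
    · exact absurd (sub_eq_zero.1 h1) hne
    · linear_combination h1
  have hp : α * β = c := by linear_combination α * hs - hα
  obtain ⟨d, hd, g, hg⟩ := exists_denom b.2
  obtain ⟨e, he, f, hf⟩ := exists_denom c.2
  refine ⟨d * e, e * g, d * f, ?_, ?_, ?_⟩
  · exact mul_ne_zero (Nat.cast_ne_zero.2 hd) (Nat.cast_ne_zero.2 he)
  · simp only [map_mul, map_natCast]
    linear_combination (d * e : ℂ) * hs - (e : ℂ) * hg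
  · simp only [map_mul, map_natCast]
    linear_combination (d * e : ℂ) * hp + (d : ℂ) * hf

open Polynomial in
theorem RootPair.isQuadratic {A B C : GaussianInt} {α β : ℂ} (h : RootPair A B C α β)
    (hi : α ∉ GaussQ) : IsQuadraticIrrational α ∧ IsQuadraticConjugate α β := by
  let b : GaussQ := ⟨(B : ℂ) / A, div_mem (toComplex_mem_gaussQ B) (toComplex_mem_gaussQ A)⟩
  let c : GaussQ := ⟨(C : ℂ) / A, div_mem (toComplex_mem_gaussQ C) (toComplex_mem_gaussQ A)⟩
  let q : GaussQ[X] := Polynomial.X ^ 2 + (Polynomial.C b * Polynomial.X + Polynomial.C c)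
  have hb : algebraMap GaussQ ℂ b = (B : ℂ) / A := rfl
  have hc : algebraMap GaussQ ℂ c = (C : ℂ) / A := rfl
  have hA := h.ne'
  have hq : ∀ z : ℂ, (A : ℂ) * z ^ 2 + B * z + C = 0 → aeval z q = 0 := by
    intro z hz
    simp only [q, map_add, map_pow, map_mul, aeval_X, aeval_C, hb, hc]
    field_simp
    linear_combination hz
  have hmon : q.Monic := monic_X_pow_add ((degree_linear_le).trans_lt (by norm_num))
  have hnat : q.natDegree = 2 := by
    simp only [q]; compute_degree!
  have hint : IsIntegral GaussQ α := ⟨q, hmon, hq α h.eval⟩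
  have h2 : 2 ≤ (minpoly GaussQ α).natDegree := by
    rw [minpoly.two_le_natDegree_iff hint]
    rintro ⟨x, hx⟩
    exact hi (hx ▸ x.2)
  have heq : q = minpoly GaussQ α := eq_of_monic_of_dvd_of_natDegree_le (minpoly.monic hint) hmon
    (minpoly.dvd GaussQ α (hq α h.eval)) (by omega)
  refine ⟨?_, (h.ne_conj hi).symm, ?_⟩
  · rw [IsQuadraticIrrational, ← heq, hnat]
  · rw [← heq]; exact hq β h.symm.eval

/-! ### Description of `N₂` by `Good` -/

theorem one_lt_norm_iff (w : ℂ) : 1 < ‖w‖ ↔ 1 < normSq w := by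
  rw [normSq_eq_norm_sq]
  exact (one_lt_sq_iff₀ (norm_nonneg w)).symm

theorem one_le_norm_iff (w : ℂ) : 1 ≤ ‖w‖ ↔ 1 ≤ normSq w := by
  rw [normSq_eq_norm_sq]
  exact (one_le_sq_iff₀ (norm_nonneg w)).symm

theorem normSq_sub_half {c : ℂ} (hc : normSq c = 2) (z : ℂ) :
    ‖z - c / 2‖ ^ 2 = (√2 / 2) ^ 2 + (normSq z - (z.re * c.re + z.im * c.im)) := by
  rw [← normSq_eq_norm_sq, div_pow, Real.sq_sqrt (by norm_num)]
  rw [normSq_apply] at hc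
  rw [normSq_apply, normSq_apply, sub_re, sub_im, div_ofNat_re, div_ofNat_im]
  linear_combination hc / 4

theorem lt_norm_sub_half {c : ℂ} (hc : normSq c = 2) (z : ℂ) :
    √2 / 2 < ‖z - c / 2‖ ↔ z.re * c.re + z.im * c.im < normSq z := by
  rw [← pow_lt_pow_iff_left₀ (by positivity) (norm_nonneg _) two_ne_zero, normSq_sub_half hc]
  constructor <;> intro h <;> linarith

theorem norm_sub_half_lt {c : ℂ} (hc : normSq c = 2) (z : ℂ) :
    ‖z - c / 2‖ < √2 / 2 ↔ normSq z < z.re * c.re + z.im * c.im := by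
  rw [← pow_lt_pow_iff_left₀ (norm_nonneg _) (by positivity) two_ne_zero, normSq_sub_half hc]
  constructor <;> intro h <;> linarith

theorem norm_sub_half_eq {c : ℂ} (hc : normSq c = 2) (z : ℂ) :
    ‖z - c / 2‖ = √2 / 2 ↔ normSq z = z.re * c.re + z.im * c.im := by
  rw [← pow_left_inj₀ (norm_nonneg _) (by positivity) two_ne_zero, normSq_sub_half hc]
  constructor <;> intro h <;> linarith

theorem normSq_I_pow_mul_one_add_I (n : ℕ) : normSq (I ^ n * (1 + I)) = 2 := by
  rw [map_mul, map_pow, normSq_I, normSq_apply]; norm_num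

theorem normSq_I_pow_mul_one_sub_I (n : ℕ) : normSq (I ^ n * (1 - I)) = 2 := by
  rw [map_mul, map_pow, normSq_I, normSq_apply]; norm_num

theorem I_pow_five : I ^ 5 = I := by rw [show 5 = 4 + 1 from rfl, pow_succ, I_pow_four, one_mul]

theorem forall_le_one {P : ℕ → Prop} : (∀ k ≤ 1, P k) ↔ P 0 ∧ P 1 :=
  ⟨fun h => ⟨h 0 (by norm_num), h 1 le_rfl⟩, fun h k hk => by interval_cases k <;> tauto⟩

theorem forall_le_two {P : ℕ → Prop} : (∀ k ≤ 2, P k) ↔ P 0 ∧ P 1 ∧ P 2 :=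
  ⟨fun h => ⟨h 0 (by norm_num), h 1 (by norm_num), h 2 le_rfl⟩,
    fun h k hk => by interval_cases k <;> tauto⟩

theorem mem_XOuter_iff {j : ℕ} {z : ℂ} : z ∈ XOuter j ↔ z ∈ X ∧ ∀ k ≤ 2,
    z.re * (I ^ (k + j - 1) * (1 + I)).re + z.im * (I ^ (k + j - 1) * (1 + I)).im < normSq z := by
  simp only [XOuter, Set.mem_ofPred_eq, lt_norm_sub_half (normSq_I_pow_mul_one_add_I _)]

theorem mem_XPetal_iff {j : ℕ} {z : ℂ} : z ∈ XPetal j ↔ z ∈ X ∧ ∀ k ≤ 1,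
    normSq z < z.re * (I ^ (k + j - 1) * (1 - I)).re + z.im * (I ^ (k + j - 1) * (1 - I)).im := by
  simp only [XPetal, Set.mem_ofPred_eq, norm_sub_half_lt (normSq_I_pow_mul_one_sub_I _)]

theorem one_le_norm_sub_iff {c : ℂ} (hc : normSq c = 2) (w : ℂ) :
    1 ≤ ‖w - c‖ ↔ 2 * (w.re * c.re + w.im * c.im) ≤ normSq w + 1 := by
  rw [normSq_apply] at hc
  rw [one_le_norm_iff, normSq_apply, normSq_apply, sub_re, sub_im]
  constructor <;> intro h <;> linarith

theorem mem_WOuter_iff {j : ℕ} {w : ℂ} : w ∈ WOuter j ↔ 1 < normSq w ∧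
    2 * (w.re * (I ^ (j - 1) * (1 - I)).re + w.im * (I ^ (j - 1) * (1 - I)).im) ≤
      normSq w + 1 := by
  simp only [WOuter, Set.mem_ofPred_eq, one_lt_norm_iff,
    one_le_norm_sub_iff (normSq_I_pow_mul_one_sub_I _)]

theorem mem_WPetal_iff {j : ℕ} {w : ℂ} : w ∈ WPetal j ↔ 1 < normSq w ∧ ∀ k ≤ 1,
    2 * (w.re * (I ^ (k + j - 1) * (1 - I)).re + w.im * (I ^ (k + j - 1) * (1 - I)).im) ≤
      normSq w + 1 := by
  simp only [WPetal, Set.mem_ofPred_eq, one_lt_norm_iff,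
    one_le_norm_sub_iff (normSq_I_pow_mul_one_sub_I _)]

theorem half_mul (c : ℂ) : c * (1 / 2 - 1 / 2 * I) = c * (1 - I) / 2 := by ring

theorem mem_K_iff {j : ℕ} {z : ℂ} : z ∈ K j ↔
    normSq z = z.re * (I ^ (j - 1) * (1 - I)).re + z.im * (I ^ (j - 1) * (1 - I)).im ∧
      normSq z ≤ 1 := by
  simp only [K, Set.mem_ofPred_eq, half_mul, norm_sub_half_eq (normSq_I_pow_mul_one_sub_I _)]
  rw [← not_lt, one_lt_norm_iff, not_lt]

theorem mem_K'_iff {j : ℕ} {z : ℂ} : z ∈ K' j ↔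
    normSq z = z.re * (I ^ (j - 1) * (1 - I)).re + z.im * (I ^ (j - 1) * (1 - I)).im ∧
      1 < normSq z := by
  simp only [K', Set.mem_ofPred_eq, half_mul, norm_sub_half_eq (normSq_I_pow_mul_one_sub_I _),
    one_lt_norm_iff]

/-- `Good` spelled out in cartesian coordinates. -/
theorem good_iff (z w : ℂ) : Good z w ↔ 1 ≤ normSq w ∧
    (normSq z < z.re - z.im → 2 * (w.re - w.im) ≤ normSq w + 1) ∧
    (normSq z < z.re + z.im → 2 * (w.re + w.im) ≤ normSq w + 1) ∧
    (normSq z ≤ -(z.re - z.im) → -(2 * (w.re - w.im)) ≤ normSq w + 1) ∧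
    (normSq z ≤ -(z.re + z.im) → -(2 * (w.re + w.im)) ≤ normSq w + 1) := by
  have hz := sq_coords z
  have hw := sq_coords w
  constructor
  · rintro ⟨h0, h1, h2, h3, h4⟩
    rw [hz] at *
    refine ⟨by linarith, fun h => ?_, fun h => ?_, fun h => ?_, fun h => ?_⟩
    · linarith [h1 (by linarith)]
    · linarith [h2 (by linarith)]
    · linarith [h3 (by linarith)]
    · linarith [h4 (by linarith)]
  · rintro ⟨h0, h1, h2, h3, h4⟩
    refine ⟨by linarith, fun h => ?_, fun h => ?_, fun h => ?_, fun h => ?_⟩ <;> rw [hz] at h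
    · linarith [h1 (by linarith)]
    · linarith [h2 (by linarith)]
    · linarith [h3 (by linarith)]
    · linarith [h4 (by linarith)]

theorem mem_N₂_iff (p : ℂ × ℂ) : p ∈ N₂ ↔
    (∃ j, (1 ≤ j ∧ j ≤ 4) ∧ p.1 ∈ XOuter j ∧ p.2 ∈ WOuter j) ∨
    (∃ j, (1 ≤ j ∧ j ≤ 4) ∧ p.1 ∈ XPetal j ∧ p.2 ∈ WPetal j) ∨
    (∃ j, (3 ≤ j ∧ j ≤ 4) ∧ p.1 ∈ Y j ∧ p.2 ∈ Y' j) ∨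
    (∃ j, (1 ≤ j ∧ j ≤ 2) ∧ p.1 ∈ K j ∧ p.2 ∈ K' j) := by
  simp only [N₂, Set.mem_union, Set.mem_iUnion, Set.mem_Icc, Set.mem_prod, exists_prop, or_assoc]

/-- With T = M, the squared inequality becomes (5M - 1)(M - 1) ≥ 0. -/
theorem two_mul_abs_le {S T M : ℝ} (hM : 1 < M) (h : S ^ 2 + T ^ 2 = 2 * M) (hT : T = M) :
    |2 * S| ≤ M + 1 := by
  subst hT
  apply abs_le_of_sq_le_sq _ (by linarith)
  nlinarith

theorem good_of_mem_N₂ {z w : ℂ} (hz : z ∈ X) (hi : z ∉ GaussQ) (h : (z, w) ∈ N₂) : Good z w := by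
  obtain ⟨x1, x2, x3, x4, x5⟩ := inX_of_mem hz hi
  have hN : 0 < normSq z := normSq_pos.2 (ne_zero_of_not_mem hi)
  have hN2 := sq_coords z
  have hW2 := sq_coords w
  rw [good_iff]
  rcases (mem_N₂_iff _).1 h with ⟨j, ⟨h1, h2⟩, h3, h4⟩ | ⟨j, ⟨h1, h2⟩, h3, h4⟩ |
    ⟨j, ⟨h1, h2⟩, h3, h4⟩ | ⟨j, ⟨h1, h2⟩, h3, h4⟩
  · simp only [mem_XOuter_iff, mem_WOuter_iff, forall_le_two] at h3 h4
    obtain ⟨-, h3, h5, h6⟩ := h3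
    obtain ⟨h4, h7⟩ := h4
    refine ⟨h4.le, ?_⟩
    interval_cases j <;>
      simp [I_sq, I_pow_three, I_pow_four, I_pow_five] at h3 h5 h6 h7 <;>
      refine ⟨?_, ?_, ?_, ?_⟩ <;> intro _ <;> linarith
  · simp only [mem_XPetal_iff, mem_WPetal_iff, forall_le_one] at h3 h4
    obtain ⟨-, h3, h5⟩ := h3
    obtain ⟨h4, h7, h8⟩ := h4
    refine ⟨h4.le, ?_⟩
    interval_cases j <;>
      simp [I_sq, I_pow_three, I_pow_four] at h3 h5 h7 h8 <;>
      refine ⟨?_, ?_, ?_, ?_⟩ <;> intro _ <;> linarith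
  · obtain ⟨s, t, hst, hs0, hs1, h3⟩ := h3
    obtain ⟨s', t', hst', hs0', ht', h4⟩ := h4
    have r1 := congrArg re h3
    have r2 := congrArg im h3
    have r3 := congrArg re h4
    have r4 := congrArg im h4
    interval_cases j <;> simp [I_sq, I_pow_three] at r1 r2 r3 r4
    · have hV : z.re - z.im = -1 := by linarith
      have hT : w.re - w.im = -1 := by linarith
      have hS : 1 ≤ w.re + w.im := by linarith
      rw [hV] at x5 hN2 ⊢
      rw [hT] at hW2 ⊢
      -- On this edge |z|² = (U² + 1)/2 ≥ U with U = re z + im z, so the one restrictive clause is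
      -- vacuous.
      refine ⟨by nlinarith, ?_, ?_, ?_, ?_⟩ <;> intro _ <;> nlinarith
    · have hV : z.re + z.im = -1 := by linarith
      have hT : w.re + w.im = -1 := by linarith
      have hS : w.re - w.im ≤ -1 := by linarith
      rw [hV] at x5 hN2 ⊢
      rw [hT] at hW2 ⊢
      -- Now the restrictive clause has a weak premise; it is vacuous because `x5` excludes the
      -- vertex -1.
      refine ⟨by nlinarith, ?_, ?_, ?_, ?_⟩ <;> intro _ <;> nlinarith
  · rw [mem_K_iff] at h3
    rw [mem_K'_iff] at h4
    obtain ⟨h3, -⟩ := h3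
    obtain ⟨h4, h5⟩ := h4
    refine ⟨h5.le, ?_⟩
    interval_cases j <;> simp at h3 h4
    · have := two_mul_abs_le h5 hW2 (by linarith)
      rw [abs_le] at this
      refine ⟨?_, ?_, ?_, ?_⟩ <;> intro _ <;> linarith
    · have := two_mul_abs_le h5 ((add_comm _ _).trans hW2) (by linarith)
      rw [abs_le] at this
      refine ⟨?_, ?_, ?_, ?_⟩ <;> intro _ <;> linarith

/-- The map z ↦ 2z - c carries the circle |z - c/2|² = 1/2 to |z|² = 2, where `normSq_eq` applies.
-/
theorem RootPair.circle {A B C : GaussianInt} {α β : ℂ} (h : RootPair A B C α β) (hi : α ∉ GaussQ)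
    (c : GaussianInt) (hc : normSq (c : ℂ) = 2)
    (hα : normSq α = α.re * (c : ℂ).re + α.im * (c : ℂ).im) :
    normSq β = β.re * (c : ℂ).re + β.im * (c : ℂ).im := by
  have hn : ∀ z : ℂ, normSq (2 * z - c) =
      4 * (normSq z - (z.re * (c : ℂ).re + z.im * (c : ℂ).im)) + 2 := by
    intro z
    rw [normSq_apply] at *
    rw [normSq_apply, sub_re, sub_im, mul_re, mul_im, re_ofNat, im_ofNat]
    linear_combination hc
  have h2 : 2 * α - c ∉ GaussQ := by
    intro hm
    apply hi
    have : α = ((2 * α - c) + c) / 2 := by ring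
    rw [this]
    exact div_mem (add_mem hm (toComplex_mem_gaussQ c)) (ofNat_mem _ 2)
  have := (h.affine c).normSq_eq h2 (n := 2) (by rw [hn, hα]; norm_num)
  rw [hn] at this
  push_cast at this
  linarith

theorem RootPair.one_lt {A B C : GaussianInt} {α β : ℂ} (h : RootPair A B C α β) (hz : α ∈ X)
    (hi : α ∉ GaussQ) (hβ : 1 ≤ normSq β) : 1 < normSq β := by
  refine hβ.lt_of_ne fun he => ?_
  have := h.symm.normSq_eq (h.not_mem hi) (n := 1) (by simpa using he.symm)
  have h1 := normSq_lt_one hz hi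
  push_cast at this
  linarith

set_option linter.unusedSimpArgs false in
-- Off the four circles, the discs containing z select an X_j, and goodness is the matching
-- condition W_j. The edge pieces Y_j × Y_j' are not needed here.
theorem mem_N₂_of_good {A B C : GaussianInt} {z w : ℂ} (hr : RootPair A B C z w) (hz : z ∈ X)
    (hi : z ∉ GaussQ) (h : Good z w) : (z, w) ∈ N₂ := by
  have hw := hr.one_lt hz hi h.one_le
  obtain ⟨x1, x2, x3, x4, x5⟩ := inX_of_mem hz hi
  have hN : 0 < normSq z := normSq_pos.2 (ne_zero_of_not_mem hi)
  have hN2 := sq_coords z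
  obtain ⟨-, g1, g2, g3, g4⟩ := (good_iff z w).1 h
  rw [mem_N₂_iff]
  have c1 := hr.circle hi ⟨1, -1⟩ (by rw [GaussianInt.toComplex_def', normSq_apply]; simp; norm_num)
  have c2 := hr.circle hi ⟨1, 1⟩ (by rw [GaussianInt.toComplex_def', normSq_apply]; simp; norm_num)
  have c3 := hr.circle hi ⟨-1, 1⟩ (by rw [GaussianInt.toComplex_def', normSq_apply]; simp; norm_num)
  have c4 := hr.circle hi ⟨-1, -1⟩
    (by rw [GaussianInt.toComplex_def', normSq_apply]; simp; norm_num)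
  simp [GaussianInt.toComplex_def'] at c1 c2 c3 c4
  rcases eq_or_ne (normSq z) (z.re - z.im) with e1 | e1
  · refine Or.inr (Or.inr (Or.inr ⟨1, by norm_num, ?_, ?_⟩))
    · rw [mem_K_iff]; simp; constructor <;> linarith
    · rw [mem_K'_iff]; simp; exact ⟨by linarith [c1 (by linarith)], hw⟩
  rcases eq_or_ne (normSq z) (z.re + z.im) with e2 | e2
  · refine Or.inr (Or.inr (Or.inr ⟨2, by norm_num, ?_, ?_⟩))
    · rw [mem_K_iff]; simp; constructor <;> linarith
    · rw [mem_K'_iff]; simp; exact ⟨by linarith [c2 (by linarith)], hw⟩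
  -- On the last two circles the clause of `Good` is active, and with w on the same circle it reads
  -- 2|w|² ≤ |w|² + 1, against |w| > 1.
  rcases eq_or_ne (normSq z) (-(z.re - z.im)) with e3 | e3
  · linarith [g3 e3.le, c3 (by linarith)]
  rcases eq_or_ne (normSq z) (-(z.re + z.im)) with e4 | e4
  · linarith [g4 e4.le, c4 (by linarith)]
  have d1 := fun h => lt_of_le_of_ne (not_lt.1 h) e1.symm
  have d2 := fun h => lt_of_le_of_ne (not_lt.1 h) e2.symm
  have d3 := fun h => lt_of_le_of_ne (not_lt.1 h) e3.symm
  have d4 := fun h => lt_of_le_of_ne (not_lt.1 h) e4.symm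
  by_cases l1 : normSq z < z.re - z.im
  · have := g1 l1
    by_cases l2 : normSq z < z.re + z.im
    · have := g2 l2
      refine Or.inr (Or.inl ⟨1, by norm_num, mem_XPetal_iff.2 ⟨hz, forall_le_one.2 ?_⟩,
        mem_WPetal_iff.2 ⟨hw, forall_le_one.2 ?_⟩⟩) <;> simp [I_sq, I_pow_three, I_pow_four] <;>
        constructor <;> linarith
    by_cases l4 : normSq z < -(z.re + z.im)
    · have := g4 l4.le
      refine Or.inr (Or.inl ⟨4, by norm_num, mem_XPetal_iff.2 ⟨hz, forall_le_one.2 ?_⟩,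
        mem_WPetal_iff.2 ⟨hw, forall_le_one.2 ?_⟩⟩) <;> simp [I_sq, I_pow_three, I_pow_four] <;>
        constructor <;> linarith
    · have := d2 l2
      have := d4 l4
      refine Or.inl ⟨1, by norm_num, mem_XOuter_iff.2 ⟨hz, forall_le_two.2 ?_⟩,
        mem_WOuter_iff.2 ⟨hw, ?_⟩⟩ <;> simp [I_sq, I_pow_three, I_pow_four, I_pow_five]
      · refine ⟨?_, ?_, ?_⟩ <;> linarith
      · linarith
  by_cases l3 : normSq z < -(z.re - z.im)
  · have := g3 l3.le
    by_cases l2 : normSq z < z.re + z.im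
    · have := g2 l2
      refine Or.inr (Or.inl ⟨2, by norm_num, mem_XPetal_iff.2 ⟨hz, forall_le_one.2 ?_⟩,
        mem_WPetal_iff.2 ⟨hw, forall_le_one.2 ?_⟩⟩) <;> simp [I_sq, I_pow_three, I_pow_four] <;>
        constructor <;> linarith
    by_cases l4 : normSq z < -(z.re + z.im)
    · have := g4 l4.le
      refine Or.inr (Or.inl ⟨3, by norm_num, mem_XPetal_iff.2 ⟨hz, forall_le_one.2 ?_⟩,
        mem_WPetal_iff.2 ⟨hw, forall_le_one.2 ?_⟩⟩) <;> simp [I_sq, I_pow_three, I_pow_four] <;>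
        constructor <;> linarith
    · have := d2 l2
      have := d4 l4
      refine Or.inl ⟨3, by norm_num, mem_XOuter_iff.2 ⟨hz, forall_le_two.2 ?_⟩,
        mem_WOuter_iff.2 ⟨hw, ?_⟩⟩ <;> simp [I_sq, I_pow_three, I_pow_four, I_pow_five]
      · refine ⟨?_, ?_, ?_⟩ <;> linarith
      · linarith
  have := d1 l1
  have := d3 l3
  by_cases l2 : normSq z < z.re + z.im
  · have := g2 l2
    refine Or.inl ⟨2, by norm_num, mem_XOuter_iff.2 ⟨hz, forall_le_two.2 ?_⟩,
      mem_WOuter_iff.2 ⟨hw, ?_⟩⟩ <;> simp [I_sq, I_pow_three, I_pow_four, I_pow_five]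
    · refine ⟨?_, ?_, ?_⟩ <;> linarith
    · linarith
  by_cases l4 : normSq z < -(z.re + z.im)
  · have := g4 l4.le
    refine Or.inl ⟨4, by norm_num, mem_XOuter_iff.2 ⟨hz, forall_le_two.2 ?_⟩,
      mem_WOuter_iff.2 ⟨hw, ?_⟩⟩ <;> simp [I_sq, I_pow_three, I_pow_four, I_pow_five]
    · refine ⟨?_, ?_, ?_⟩ <;> linarith
    · linarith
  have := d2 l2
  have := d4 l4
  exfalso
  -- Outside all four discs |U|, |V| < |z|², while |U|, |V| ≤ 1 give 2|z|² = U² + V² ≤ |U| + |V|.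
  nlinarith

/-! ### Finiteness of the set of reduced quadratic irrationals of given discriminant -/

/-- `1 / (z - 1)` for `z` in the sector of the square at the vertex `1`. -/
theorem inv_sub_one_of_sector {z : ℂ} (h1 : z ≠ 1) (hz : |z.im| ≤ z.re) (hz' : z.re + |z.im| ≤ 1) :
    ((z - 1)⁻¹).re ≤ -1 ∧ |((z - 1)⁻¹).im| ≤ -((z - 1)⁻¹).re := by
  have hN : 0 < normSq (z - 1) := normSq_pos.2 (sub_ne_zero.2 h1)
  rw [inv_re, inv_im, ← neg_div, abs_div, abs_of_pos hN, abs_neg]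
  refine ⟨?_, ?_⟩
  · rw [div_le_iff₀ hN, normSq_apply]
    simp only [sub_re, one_re, sub_im, one_im, sub_zero]
    have h2 : z.im * z.im = |z.im| * |z.im| := (abs_mul_abs_self _).symm
    have h3 : 0 ≤ |z.im| := abs_nonneg _
    rw [h2]
    nlinarith
  · apply div_le_div_of_nonneg_right _ hN.le
    simp only [sub_re, one_re, sub_im, one_im, sub_zero]
    linarith

theorem inv_sub_one_re_of_one_le {w : ℂ} (h1 : w ≠ 1) (hw : 1 ≤ normSq w) :
    -1 / 2 ≤ ((w - 1)⁻¹).re := by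
  have hN : 0 < normSq (w - 1) := normSq_pos.2 (sub_ne_zero.2 h1)
  rw [inv_re, le_div_iff₀ hN]
  rw [normSq_apply] at *
  simp only [sub_re, one_re, sub_im, one_im, sub_zero]
  linarith

/-- Sending the vertex 1 to ∞ gives ζ, ω with Re ζ ≤ -1 and Re ω ≥ -1/2, so |ω - ζ| ≥ 1/2. Since
|F||ω - ζ| = r and |F| ≥ 1, F and ω - ζ are bounded. The sector bounds |Im ζ| by -Re ζ, so ζ and ω
are bounded too, and A = Fζω. -/
theorem leading_coeff_bound {A z w : ℂ} {r : ℝ} (hz : |z.im| ≤ z.re) (hz' : z.re + |z.im| ≤ 1)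
    (hw : 1 ≤ normSq w) (hr : ‖A * (z - w)‖ = r) (hF : 1 ≤ ‖A * ((z - 1) * (w - 1))‖) :
    ‖A‖ ≤ 2 * r * ((1 + 2 * r) * (1 + 3 * r)) := by
  have z1 : z ≠ 1 := by rintro rfl; norm_num at hF
  have w1 : w ≠ 1 := by rintro rfl; norm_num at hF
  obtain ⟨a1, a2⟩ := inv_sub_one_of_sector z1 hz hz'
  have b1 := inv_sub_one_re_of_one_le w1 hw
  have z2 := sub_ne_zero.2 z1
  have w2 := sub_ne_zero.2 w1
  set F := A * ((z - 1) * (w - 1)) with hFd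
  have e1 : F * ((w - 1)⁻¹ - (z - 1)⁻¹) = A * (z - w) := by
    rw [hFd]; field_simp; ring
  have e2 : A = F * ((z - 1)⁻¹ * (w - 1)⁻¹) := by
    rw [hFd]; field_simp
  set ζ := (z - 1)⁻¹
  set ω := (w - 1)⁻¹
  rw [← e1, norm_mul] at hr
  have d1 : 1 / 2 ≤ ‖ω - ζ‖ := by
    refine le_trans ?_ (re_le_norm _)
    rw [sub_re]; linarith
  have d2 : ‖ω - ζ‖ ≤ r := by nlinarith [norm_nonneg (ω - ζ)]
  have d3 : ‖F‖ ≤ 2 * r := by nlinarith [norm_nonneg F]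
  have d4 : ω.re - ζ.re ≤ r := by
    rw [← sub_re]; exact (re_le_norm _).trans d2
  have d5 : ‖ζ‖ ≤ 1 + 2 * r := by
    refine (norm_le_abs_re_add_abs_im ζ).trans ?_
    rw [abs_of_nonpos (by linarith : ζ.re ≤ 0)]
    linarith
  have d6 : ‖ω‖ ≤ 1 + 3 * r := by
    have := norm_le_norm_add_norm_sub' ω ζ
    linarith
  have hr0 : 0 ≤ r := by linarith
  calc ‖A‖ = ‖F‖ * (‖ζ‖ * ‖ω‖) := by rw [← norm_mul, ← norm_mul, ← e2]
    _ ≤ _ := by gcongr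

theorem one_le_norm_gaussianInt {g : GaussianInt} (hg : g ≠ 0) : 1 ≤ ‖(g : ℂ)‖ := by
  rw [one_le_norm_iff, ← GaussianInt.intCast_real_norm]
  exact_mod_cast GaussianInt.norm_pos.2 hg

theorem finite_norm_le (R : ℝ) : {g : GaussianInt | ‖(g : ℂ)‖ ≤ R}.Finite := by
  have hf : (Set.Icc (-⌈R⌉) ⌈R⌉ ×ˢ Set.Icc (-⌈R⌉) ⌈R⌉).Finite :=
    (Set.finite_Icc _ _).prod (Set.finite_Icc _ _)
  refine Set.Finite.of_finite_image (f := fun g : GaussianInt => (g.re, g.im)) (hf.subset ?_) ?_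
  · rintro _ ⟨g, hg, rfl⟩
    have h1 := (abs_re_le_norm (g : ℂ)).trans (hg.trans (Int.le_ceil R))
    have h2 := (abs_im_le_norm (g : ℂ)).trans (hg.trans (Int.le_ceil R))
    rw [← GaussianInt.intCast_re] at h1
    rw [← GaussianInt.intCast_im] at h2
    simp only [Set.mem_prod, Set.mem_Icc]
    exact ⟨abs_le.1 (by exact_mod_cast h1), abs_le.1 (by exact_mod_cast h2)⟩
  · intro g _ g' _ h
    exact Zsqrtd.ext (congrArg Prod.fst h) (congrArg Prod.snd h)

/-- Every point of the square lies, up to rotation, in the sector at the vertex `1`. -/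
theorem exists_rotation {z : ℂ} (hz : z ∈ X) : ∃ κ : GaussianInt, ‖(κ : ℂ)‖ = 1 ∧
    |(z * κ).im| ≤ (z * κ).re ∧ (z * κ).re + |(z * κ).im| ≤ 1 := by
  obtain ⟨h1, h2, h3, h4⟩ := (mem_X_iff z).1 hz
  have hn : ∀ x y : ℤ, ‖((⟨x, y⟩ : GaussianInt) : ℂ)‖ = 1 ↔ x * x + y * y = 1 := by
    intro x y
    rw [← sq_eq_sq₀ (norm_nonneg _) zero_le_one, ← normSq_eq_norm_sq, normSq_apply]
    simp only [GaussianInt.re_toComplex, GaussianInt.im_toComplex, one_pow]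
    exact_mod_cast Iff.rfl
  simp only [abs_le, ← le_sub_iff_add_le']
  rcases le_total z.re z.im with a | a <;> rcases le_total 0 (z.re + z.im) with b | b
  · refine ⟨⟨0, -1⟩, (hn _ _).2 rfl, ?_⟩
    simp [GaussianInt.toComplex_def']
    refine ⟨⟨?_, ?_⟩, ?_, ?_⟩ <;> linarith
  · refine ⟨⟨-1, 0⟩, (hn _ _).2 rfl, ?_⟩
    simp [GaussianInt.toComplex_def']
    refine ⟨⟨?_, ?_⟩, ?_, ?_⟩ <;> linarith
  · refine ⟨⟨1, 0⟩, (hn _ _).2 rfl, ?_⟩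
    simp [GaussianInt.toComplex_def']
    refine ⟨⟨?_, ?_⟩, ?_, ?_⟩ <;> linarith
  · refine ⟨⟨0, 1⟩, (hn _ _).2 rfl, ?_⟩
    simp [GaussianInt.toComplex_def']
    refine ⟨⟨?_, ?_⟩, ?_, ?_⟩ <;> linarith

theorem RootPair.leading_bound {A B C : GaussianInt} {z w : ℂ} (h : RootPair A B C z w)
    (hz : z ∈ X) (hi : z ∉ GaussQ) (hw : 1 ≤ normSq w) :
    ‖(A : ℂ)‖ ≤ 2 * ‖A * (z - w)‖ * ((1 + 2 * ‖A * (z - w)‖) * (1 + 3 * ‖A * (z - w)‖)) := by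
  obtain ⟨κ, hκ, h1, h2⟩ := exists_rotation hz
  have hκ0 : (κ : ℂ) ≠ 0 := by rw [← norm_pos_iff, hκ]; exact one_pos
  refine leading_coeff_bound (w := w * κ) h1 h2 ?_ ?_ ?_
  · rwa [map_mul, normSq_eq_norm_sq (κ : ℂ), hκ, one_pow, mul_one]
  · rw [← sub_mul, ← mul_assoc, norm_mul _ (κ : ℂ), hκ, mul_one]
  -- This is κ² times the quadratic polynomial at κ⁻¹: a Gaussian integer, nonzero because both
  -- roots are irrational.
  · have e : (A : ℂ) * ((z * κ - 1) * (w * κ - 1)) =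
        ((A + B * κ + C * κ ^ 2 : GaussianInt) : ℂ) := by
      simp only [map_add, map_mul, map_pow]
      linear_combination (κ : ℂ) ^ 2 * h.prod - (κ : ℂ) * h.sum
    rw [e]
    apply one_le_norm_gaussianInt
    intro h0
    rw [h0, map_zero] at e
    have key : ∀ x : ℂ, x ∉ GaussQ → x * κ - 1 ≠ 0 := by
      intro x hx h3
      apply hx
      rw [eq_div_of_mul_eq hκ0 (sub_eq_zero.1 h3)]
      exact div_mem (one_mem _) (toComplex_mem_gaussQ κ)
    exact mul_ne_zero h.ne' (mul_ne_zero (key z hi) (key w (h.not_mem hi))) e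

theorem finite_roots {A B C : GaussianInt} (hA : A ≠ 0) :
    {z : ℂ | (A : ℂ) * z ^ 2 + B * z + C = 0}.Finite := by
  have hp : (Polynomial.C (A : ℂ) * Polynomial.X ^ 2 + Polynomial.C (B : ℂ) * Polynomial.X +
      Polynomial.C (C : ℂ)) ≠ 0 := by
    intro h
    have := congrArg (fun p => Polynomial.coeff p 2) h
    simp at this
    exact hA this
  refine (Polynomial.finite_setOfPred_isRoot hp).subset fun z hz => ?_
  simpa [Polynomial.IsRoot] using hz

/-- `R` bounds |A|. As |z| < 1 and |A(z - w)| = √|Δ|, the products Az and Aw are bounded, and with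
them B and C. -/
theorem finite_reduced (Δ : GaussianInt) : {z : ℂ | z ∈ X ∧ z ∉ GaussQ ∧ ∃ A B C w,
    RootPair A B C z w ∧ 1 ≤ normSq w ∧ B ^ 2 - 4 * A * C = Δ}.Finite := by
  set r : ℝ := √‖(Δ : ℂ)‖ with hr
  set R : ℝ := 2 * r * ((1 + 2 * r) * (1 + 3 * r)) with hR
  let S : Set GaussianInt := {g : GaussianInt | ‖(g : ℂ)‖ ≤ 2 * R + r}
  have hS : S.Finite := finite_norm_le _
  have hfin : (⋃ A ∈ {A ∈ S | A ≠ 0}, ⋃ B ∈ S, ⋃ C ∈ S,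
      {z : ℂ | (A : ℂ) * z ^ 2 + B * z + C = 0}).Finite :=
    (hS.subset (Set.sep_subset _ _)).biUnion fun A hA => hS.biUnion fun B _ => hS.biUnion fun C _ =>
      finite_roots hA.2
  refine hfin.subset ?_
  rintro z ⟨hz, hi, A, B, C, w, h, hw, hΔ⟩
  have hn : ‖A * (z - w)‖ = r := by
    rw [hr, ← hΔ, ← h.disc_eq, norm_pow, Real.sqrt_sq (norm_nonneg _)]
  have hA := h.leading_bound hz hi hw
  rw [hn] at hA
  have hz1 : ‖z‖ ≤ 1 := by
    by_contra hc
    exact (normSq_lt_one hz hi).not_gt ((one_lt_norm_iff z).1 (not_le.1 hc))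
  have hAz : ‖A * z‖ ≤ R := by
    rw [norm_mul]
    exact (mul_le_of_le_one_right (norm_nonneg _) hz1).trans hA
  have hAw : ‖A * w‖ ≤ R + r := by
    have : A * w = A * z - A * (z - w) := by ring
    rw [this]
    exact (norm_sub_le _ _).trans (by linarith)
  have hr0 : 0 ≤ r := Real.sqrt_nonneg _
  have hR0 : 0 ≤ R := (norm_nonneg _).trans hA
  have hB : ‖(B : ℂ)‖ ≤ 2 * R + r := by
    have : (B : ℂ) = -(A * z + A * w) := by rw [← mul_add, h.sum, neg_neg]
    rw [this, norm_neg]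
    exact (norm_add_le _ _).trans (by linarith)
  have hC : ‖(C : ℂ)‖ ≤ 2 * R + r := by
    have : (C : ℂ) = A * w * z := by linear_combination -h.prod
    rw [this, norm_mul]
    exact (mul_le_of_le_one_right (norm_nonneg _) hz1).trans (by linarith)
  simp only [Set.mem_iUnion]
  have hA' : ‖(A : ℂ)‖ ≤ 2 * R + r := by linarith
  exact ⟨A, ⟨hA', h.ne⟩, B, hB, C, hC, h.eval⟩

/-! ### Orbits of the natural extension -/

/-- The second coordinate of the natural extension along the orbit of `α`. -/
noncomputable def dualOrbit (α β : ℂ) : ℕ → ℂ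
  | 0 => β
  | n + 1 => (dualOrbit α β n)⁻¹ - digit (orbitT α n)⁻¹

theorem orbitT_not_mem {α : ℂ} (hi : α ∉ GaussQ) (n : ℕ) : orbitT α n ∉ GaussQ := by
  induction n with
  | zero => exact hi
  | succ n ih => exact mapT_not_mem ih

theorem orbitT_mem_X {α : ℂ} (hα : α ∈ X) (hi : α ∉ GaussQ) (n : ℕ) : orbitT α n ∈ X := by
  cases n with
  | zero => exact hα
  | succ n => exact mapT_mem_X (orbitT_not_mem hi n)

theorem orbitT_succ {α : ℂ} (hi : α ∉ GaussQ) (n : ℕ) :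
    orbitT α (n + 1) = (orbitT α n)⁻¹ - digit (orbitT α n)⁻¹ :=
  mapT_eq_digit (ne_zero_of_not_mem (orbitT_not_mem hi n))

theorem good_dualOrbit {α β : ℂ} (hα : α ∈ X) (hi : α ∉ GaussQ) (h : Good α β) (n : ℕ) :
    Good (orbitT α n) (dualOrbit α β n) := by
  induction n with
  | zero => exact h
  | succ n ih => exact ih.step (orbitT_mem_X hα hi n) (orbitT_not_mem hi n)

theorem exists_rootPair_orbit {α β : ℂ} (hi : α ∉ GaussQ) {A B C : GaussianInt}
    (h : RootPair A B C α β) (n : ℕ) : ∃ A' B' C',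
      RootPair A' B' C' (orbitT α n) (dualOrbit α β n) ∧ B' ^ 2 - 4 * A' * C' = B ^ 2 - 4 * A * C ∧
      (A' : ℂ) = A * ∏ i ∈ Finset.range n, orbitT α i * dualOrbit α β i := by
  induction n with
  | zero => exact ⟨A, B, C, h, rfl, by simp⟩
  | succ n ih =>
    obtain ⟨A', B', C', h', hd, hp⟩ := ih
    have h1 := h'.step (orbitT_not_mem hi n) (digit (orbitT α n)⁻¹)
    rw [← orbitT_succ hi] at h1
    refine ⟨_, _, _, h1, ?_, ?_⟩
    · rw [← hd]; ring
    · rw [Finset.prod_range_succ, ← mul_assoc, ← hp, h'.prod]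

theorem purelyPeriodic_of_good {α β : ℂ} (hα : α ∈ X) (hi : α ∉ GaussQ) {A B C : GaussianInt}
    (h : RootPair A B C α β) (hg : Good α β) : PurelyPeriodicT α := by
  refine ⟨fun n => ne_zero_of_not_mem (orbitT_not_mem hi n), ?_⟩
  have hgood := good_dualOrbit hα hi hg
  have hroot := exists_rootPair_orbit hi h
  have hmem := orbitT_not_mem hi
  have hX := orbitT_mem_X hα hi
  have heq : ∀ i j, orbitT α i = orbitT α j → dualOrbit α β i = dualOrbit α β j := by
    intro i j hij
    obtain ⟨_, _, _, hi', -⟩ := hroot i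
    obtain ⟨_, _, _, hj', -⟩ := hroot j
    rw [hij] at hi'
    exact hj'.conj_unique (hmem j) hi'
  -- Injectivity needs the strict inequality, which arithmetic supplies for conjugates.
  have hone : ∀ n, 1 < normSq (dualOrbit α β n) := by
    intro n
    obtain ⟨_, _, _, h', -⟩ := hroot n
    exact h'.one_lt (hX n) (hmem n) (hgood n).one_le
  have hdesc : ∀ p i, orbitT α (i + p) = orbitT α i → orbitT α p = α := by
    intro p i
    induction i with
    | zero => intro h'; rwa [zero_add] at h'
    | succ i ih =>
      intro h'
      rw [add_right_comm] at h'
      exact ih (Good.injective (hmem _) (hmem _) (hgood _) (hgood _) (hone _) (hone _) h'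
        (heq _ _ h'))
  have hninj : ¬ Function.Injective (orbitT α) := fun hinj =>
    Set.infinite_range_of_injective hinj <| (finite_reduced (B ^ 2 - 4 * A * C)).subset <| by
      rintro _ ⟨n, rfl⟩
      obtain ⟨A', B', C', h', hd, -⟩ := hroot n
      exact ⟨hX n, hmem n, A', B', C', _, h', (hone n).le, hd⟩
  have hper : ∃ p, 0 < p ∧ orbitT α p = α := by
    simp only [Function.Injective, not_forall] at hninj
    obtain ⟨i, j, hij, hne⟩ := hninj
    rcases lt_or_gt_of_ne hne with hlt | hlt
    · exact ⟨j - i, by omega, hdesc _ i (by rw [hij]; congr 1; omega)⟩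
    · exact ⟨i - j, by omega, hdesc _ j (by rw [← hij]; congr 1; omega)⟩
  obtain ⟨p, hp, hpα⟩ := hper
  refine ⟨p, hp, fun n => ?_⟩
  induction n with
  | zero => rw [zero_add]; exact hpα
  | succ n ih => rw [add_right_comm]; exact congrArg mapT ih

open Filter Topology

/-! ### Purely periodic orbits -/

/-- α is a Möbius image of its n-th iterate; the denominator is the inverse of the product of the
earlier iterates. -/
theorem exists_mobius {α : ℂ} (hi : α ∉ GaussQ) (n : ℕ) : ∃ p q r s : GaussianInt,
    (p * s - q * r) ^ 2 = 1 ∧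
      α = (∏ i ∈ Finset.range n, orbitT α i) * (p * orbitT α n + q) ∧
      1 = (∏ i ∈ Finset.range n, orbitT α i) * (r * orbitT α n + s) := by
  induction n with
  | zero => exact ⟨1, 0, 0, 1, by ring, by simp [orbitT], by simp⟩
  | succ n ih =>
    obtain ⟨p, q, r, s, h1, h2, h3⟩ := ih
    set d := digit (orbitT α n)⁻¹
    have hn : orbitT α n ≠ 0 := ne_zero_of_not_mem (orbitT_not_mem hi n)
    have hd : orbitT α n * (orbitT α (n + 1) + d) = 1 := by
      rw [orbitT_succ hi, sub_add_cancel, mul_inv_cancel₀ hn]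
    refine ⟨q, p + q * d, s, r + s * d, by rw [← h1]; ring, ?_, ?_⟩
    · refine h2.trans ?_
      rw [Finset.prod_range_succ]
      simp only [map_add, map_mul]
      linear_combination -(∏ i ∈ Finset.range n, orbitT α i) * q * hd
    · refine h3.trans ?_
      rw [Finset.prod_range_succ]
      simp only [map_add, map_mul]
      linear_combination -(∏ i ∈ Finset.range n, orbitT α i) * s * hd

theorem norm_orbitT_lt_one {α : ℂ} (hα : α ∈ X) (hi : α ∉ GaussQ) (n : ℕ) :
    ‖orbitT α n‖ < 1 := by
  have := normSq_lt_one (orbitT_mem_X hα hi n) (orbitT_not_mem hi n)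
  rw [normSq_eq_norm_sq] at this
  exact (sq_lt_one_iff₀ (norm_nonneg _)).1 this

theorem norm_prod_orbitT_lt_one {α : ℂ} (hα : α ∈ X) (hi : α ∉ GaussQ) {n : ℕ} (hn : 0 < n) :
    ‖∏ i ∈ Finset.range n, orbitT α i‖ < 1 := by
  obtain ⟨n, rfl⟩ := Nat.exists_eq_add_of_lt hn
  rw [zero_add, Finset.prod_range_succ, norm_mul, norm_prod]
  exact mul_lt_one_of_nonneg_of_lt_one_right
    (Finset.prod_le_one (fun i _ => norm_nonneg _) fun i _ => (norm_orbitT_lt_one hα hi i).le)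
    (norm_nonneg _) (norm_orbitT_lt_one hα hi n)

theorem exists_rootPair_of_periodic {α : ℂ} (hα : α ∈ X) (hi : α ∉ GaussQ) {n : ℕ} (hn : 0 < n)
    (hp : orbitT α n = α) : ∃ A B C β, RootPair A B C α β := by
  obtain ⟨p, q, r, s, h1, h2, h3⟩ := exists_mobius hi n
  rw [hp] at h2 h3
  have hP := norm_prod_orbitT_lt_one hα hi hn
  set P := ∏ i ∈ Finset.range n, orbitT α i
  have hP0 : P ≠ 0 := by rintro h; rw [h, zero_mul] at h3; exact one_ne_zero h3
  have hq : (r : ℂ) * α ^ 2 + (s - p : GaussianInt) * α + (-q : GaussianInt) = 0 := by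
    simp only [map_sub, map_neg]
    apply mul_left_cancel₀ hP0
    linear_combination h2 - α * h3
  -- If r = 0 then p = s has modulus 1, contradicting 1 = P s with |P| < 1.
  by_cases hr : r = 0
  · exfalso
    subst hr
    rw [map_zero, zero_mul, zero_add] at hq h3
    obtain ⟨h4, -⟩ := eq_zero_of_linear hi hq
    rw [← sub_eq_zero.1 h4, mul_zero, sub_zero] at h1
    have h5 := congrArg (fun g : GaussianInt => ‖(g : ℂ)‖) h1
    simp only [map_pow, map_mul, map_one, norm_pow, norm_mul, norm_one] at h5
    have h6 : ‖(s : ℂ)‖ = 1 := by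
      have : ‖(s : ℂ)‖ ^ 4 = 1 := by rw [← h5]; ring
      exact (pow_eq_one_iff_of_nonneg (norm_nonneg _) (by norm_num)).1 this
    have h7 := congrArg norm h3
    rw [norm_one, norm_mul, h6, mul_one] at h7
    linarith
  · have hr' : (r : ℂ) ≠ 0 := fun h => hr (GaussianInt.toComplex_eq_zero.1 h)
    refine ⟨r, s - p, -q, -((s - p : GaussianInt) : ℂ) / r - α, hr, ?_, ?_⟩
    · rw [add_sub_cancel, mul_div_cancel₀ _ hr']
    · field_simp
      linear_combination (-1 : ℂ) * hq

/-- Each step is one Möbius map applied to all three points, so (w - β)/(w - α) is multiplied by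
α_i/β_i. -/
theorem dualOrbit_cross_ratio {α β w : ℂ} (hi : α ∉ GaussQ) (hβ : ∀ n, dualOrbit α β n ≠ 0)
    (hw : ∀ n, dualOrbit α w n ≠ 0) (n : ℕ) :
    (dualOrbit α w n - dualOrbit α β n) * (w - α) * ∏ i ∈ Finset.range n, dualOrbit α β i =
      (w - β) * (dualOrbit α w n - orbitT α n) * ∏ i ∈ Finset.range n, orbitT α i := by
  induction n with
  | zero => simp [dualOrbit, orbitT]
  | succ n ih =>
    have h1 := hβ n
    have h2 := hw n
    have h3 := ne_zero_of_not_mem (orbitT_not_mem hi n)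
    rw [Finset.prod_range_succ, Finset.prod_range_succ, orbitT_succ hi, dualOrbit, dualOrbit,
      sub_sub_sub_cancel_right, sub_sub_sub_cancel_right, inv_sub_inv h2 h1, inv_sub_inv h2 h3]
    field_simp
    linear_combination (-1 : ℂ) * ih

theorem Good.of_tendsto {z w : ℂ} {u : ℕ → ℂ} (hu : Tendsto u atTop (𝓝 w))
    (h : ∀ n, Good z (u n)) : Good z w := by
  have hre : Tendsto (fun n => (u n).re) atTop (𝓝 w.re) := (continuous_re.tendsto w).comp hu
  have him : Tendsto (fun n => (u n).im) atTop (𝓝 w.im) := (continuous_im.tendsto w).comp hu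
  have hN : Tendsto (fun n => normSq (u n)) atTop (𝓝 (normSq w)) :=
    (continuous_normSq.tendsto w).comp hu
  simp only [good_iff] at h ⊢
  refine ⟨ge_of_tendsto' hN fun n => (h n).1, fun hc => ?_, fun hc => ?_, fun hc => ?_,
    fun hc => ?_⟩
  · exact le_of_tendsto_of_tendsto' ((hre.sub him).const_mul 2) (hN.add_const 1)
      fun n => (h n).2.1 hc
  · exact le_of_tendsto_of_tendsto' ((hre.add him).const_mul 2) (hN.add_const 1)
      fun n => (h n).2.2.1 hc
  · exact le_of_tendsto_of_tendsto' ((hre.sub him).const_mul 2).neg (hN.add_const 1)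
      fun n => (h n).2.2.2.1 hc
  · exact le_of_tendsto_of_tendsto' ((hre.add him).const_mul 2).neg (hN.add_const 1)
      fun n => (h n).2.2.2.2 hc

theorem orbitT_mul_add {α : ℂ} {p : ℕ} (hp : ∀ n, orbitT α (n + p) = orbitT α n) (k i : ℕ) :
    orbitT α (k * p + i) = orbitT α i := by
  induction k with
  | zero => rw [zero_mul, zero_add]
  | succ k ih => rw [Nat.succ_mul, add_right_comm, hp, ih]

theorem prod_orbitT_mul {α : ℂ} {p : ℕ} (hp : ∀ n, orbitT α (n + p) = orbitT α n) (k : ℕ) :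
    ∏ i ∈ Finset.range (k * p), orbitT α i = (∏ i ∈ Finset.range p, orbitT α i) ^ k := by
  induction k with
  | zero => simp
  | succ k ih =>
    rw [Nat.succ_mul, Finset.prod_range_add, ih, pow_succ]
    simp only [orbitT_mul_add hp]

theorem good_conj_of_periodic {α β w : ℂ} (hα : α ∈ X) (hi : α ∉ GaussQ) {A B C : GaussianInt}
    (h : RootPair A B C α β) {p : ℕ} (hp0 : 0 < p) (hp : ∀ n, orbitT α (n + p) = orbitT α n)
    (hw : Good α w) : Good α β := by
  have hk : ∀ k, orbitT α (k * p) = α := fun k => orbitT_mul_add hp k 0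
  have hwn : ∀ n, dualOrbit α w n ≠ 0 := by
    intro n h0
    have := (good_dualOrbit hα hi hw n).one_le
    rw [h0, map_zero] at this
    linarith
  have hβn : ∀ n, dualOrbit α β n ≠ 0 := by
    intro n
    obtain ⟨_, _, _, h', -⟩ := exists_rootPair_orbit hi h n
    exact ne_zero_of_not_mem (h'.not_mem (orbitT_not_mem hi n))
  set P := ∏ i ∈ Finset.range p, orbitT α i with hP
  have hP1 : ‖P‖ < 1 := norm_prod_orbitT_lt_one hα hi hp0
  have hwα : w - α ≠ 0 := by
    intro h0
    have h1 := hw.one_le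
    rw [sub_eq_zero.1 h0] at h1
    linarith [normSq_lt_one hα hi]
  -- After whole periods α, hence its conjugate, returns. The discriminant is unchanged, so the
  -- leading coefficient keeps its modulus; its multiplier is the product of the α_i β_i.
  have hstep : ∀ k, dualOrbit α β (k * p) = β ∧
      ‖∏ i ∈ Finset.range (k * p), orbitT α i * dualOrbit α β i‖ = 1 := by
    intro k
    obtain ⟨A', B', C', h', hd, hA⟩ := exists_rootPair_orbit hi h (k * p)
    rw [hk] at h'
    have hβ := h.conj_unique hi h'
    refine ⟨hβ, ?_⟩
    rw [hβ] at h'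
    have h1 := h'.disc_eq
    rw [hd, ← h.disc_eq, hA] at h1
    have h2 := congrArg norm h1
    simp only [norm_pow, norm_mul] at h2
    have h3 := (pow_left_inj₀ (by positivity) (by positivity) two_ne_zero).1 h2
    have h4 : ‖(A : ℂ)‖ * ‖α - β‖ ≠ 0 :=
      mul_ne_zero (norm_ne_zero_iff.2 h.ne') (norm_ne_zero_iff.2 (sub_ne_zero.2 (h.ne_conj hi)))
    apply mul_left_cancel₀ h4
    linear_combination h3
  -- `Q k` is ∏α_i / ∏β_i over k periods, written so that its denominator has modulus 1; thus |Q k|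
  -- = |P|^(2k).
  let Q : ℕ → ℂ := fun k =>
    (P ^ k) ^ 2 / ∏ i ∈ Finset.range (k * p), orbitT α i * dualOrbit α β i
  have hQ : Tendsto Q atTop (𝓝 0) := by
    rw [tendsto_zero_iff_norm_tendsto_zero]
    have : ∀ k, ‖Q k‖ = (‖P‖ ^ 2) ^ k := by
      intro k
      simp only [Q]
      rw [norm_div, (hstep k).2, div_one, norm_pow, norm_pow]
      ring
    simp only [this]
    exact tendsto_pow_atTop_nhds_zero_of_lt_one (by positivity)
      (pow_lt_one₀ (norm_nonneg _) hP1 two_ne_zero)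
  have hrel : ∀ k, (dualOrbit α w (k * p) - β) * (w - α - (w - β) * Q k) =
      (w - β) * Q k * (β - α) := by
    intro k
    have h1 := dualOrbit_cross_ratio hi hβn hwn (k * p)
    have hb : ∏ i ∈ Finset.range (k * p), dualOrbit α β i ≠ 0 :=
      Finset.prod_ne_zero_iff.2 fun i _ => hβn i
    have ha : ∏ i ∈ Finset.range (k * p), orbitT α i ≠ 0 :=
      Finset.prod_ne_zero_iff.2 fun i _ => ne_zero_of_not_mem (orbitT_not_mem hi i)
    have hQk : Q k * ∏ i ∈ Finset.range (k * p), dualOrbit α β i =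
        ∏ i ∈ Finset.range (k * p), orbitT α i := by
      simp only [Q]
      rw [Finset.prod_mul_distrib, hP, ← prod_orbitT_mul hp]
      field_simp
    rw [hk, (hstep k).1, ← hQk] at h1
    apply mul_right_cancel₀ hb
    linear_combination h1
  have hden : Tendsto (fun k => w - α - (w - β) * Q k) atTop (𝓝 (w - α)) := by
    simpa using (hQ.const_mul (w - β)).const_sub (w - α)
  have hnum : Tendsto (fun k => (w - β) * Q k * (β - α)) atTop (𝓝 0) := by
    simpa using (hQ.const_mul (w - β)).mul_const (β - α)
  have hlim : Tendsto (fun k => dualOrbit α w (k * p)) atTop (𝓝 β) := by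
    have h1 : Tendsto (fun k => (w - β) * Q k * (β - α) / (w - α - (w - β) * Q k) + β) atTop
        (𝓝 β) := by
      simpa using (hnum.div hden hwα).add_const β
    refine h1.congr' ?_
    filter_upwards [hden.eventually_ne hwα] with k hne
    rw [← hrel k, mul_div_cancel_right₀ _ hne, sub_add_cancel]
  refine Good.of_tendsto hlim fun k => ?_
  have := good_dualOrbit hα hi hw (k * p)
  rwa [hk] at this

theorem exists_good_of_periodic {α : ℂ} (hα : α ∈ X) (hi : α ∉ GaussQ) {p : ℕ} (hp0 : 0 < p)
    (hp : orbitT α p = α) : ∃ w, Good α w := by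
  obtain ⟨n, rfl⟩ := Nat.exists_eq_add_of_lt hp0
  rw [zero_add] at hp
  have := (invGood_zero (orbitT α n)⁻¹).step (orbitT_mem_X hα hi n) (orbitT_not_mem hi n)
  rw [show mapT (orbitT α n) = α from hp] at this
  exact ⟨_, this⟩

end HurwitzTanaka

/-! ### The characterization of pure periodicity. -/

theorem theorem6p3 (α : ℂ) (hα : α ∈ HurwitzTanaka.X)
    (hirr : α ∉ HurwitzTanaka.GaussQ) :
    HurwitzTanaka.PurelyPeriodicT α ↔
      HurwitzTanaka.IsQuadraticIrrational α ∧
        ∃ α' : ℂ, HurwitzTanaka.IsQuadraticConjugate α α' ∧ (α, α') ∈ HurwitzTanaka.N₂ := by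
  constructor
  · rintro ⟨-, p, hp0, hp⟩
    have hpα : HurwitzTanaka.orbitT α p = α := by
      have := hp 0
      rwa [zero_add] at this
    obtain ⟨A, B, C, β, h⟩ := HurwitzTanaka.exists_rootPair_of_periodic hα hirr hp0 hpα
    obtain ⟨w, hw⟩ := HurwitzTanaka.exists_good_of_periodic hα hirr hp0 hpα
    obtain ⟨h1, h2⟩ := h.isQuadratic hirr
    exact ⟨h1, β, h2, HurwitzTanaka.mem_N₂_of_good h hα hirr
      (HurwitzTanaka.good_conj_of_periodic hα hirr h hp0 hp hw)⟩
  · rintro ⟨h1, β, h2, h3⟩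
    obtain ⟨A, B, C, h⟩ := HurwitzTanaka.exists_rootPair h1 h2
    exact HurwitzTanaka.purelyPeriodic_of_good hα hirr h
      (HurwitzTanaka.good_of_mem_N₂ hα hirr h3)
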